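/- Theorem 2.5. Let $n\ge 2$, let $B_n=\{x\in\mathbb R^n:|x|\le 1\}$, and let $\varphi$ be a (real- or complex-valued) function on $B_n$ satisfying, for some $0<\lambda\le 1$ and $A>0$, the condition $|\varphi(x)-\varphi(y)|\le A|x-y|^\lambda$ for all $x,y\in B_n$. Extend $\varphi$ by zero outside $B_n$. For $\theta\in S^{n-1}$ and $t\in\mathbb R$ let $$\Phi(\theta,t)=(R\varphi)(\theta,t)=\int_{\{x\in\mathbb R^n:\,x\cdot\theta=t\}}\varphi(x)\,d_{\theta,t}x$$ be the Radon transform of $\varphi$, where $d_{\theta,t}x$ is the $(n-1)$-dimensional volume element of the hyperplane. For a function $\Psi$ on $S^{n-1}\times\mathbb R$ put $$(R^*\Psi)(x)=\frac1{\sigma_{n-1}}\int_{S^{n-1}}\Psi(\theta,x\cdot\theta)\,d\sigma(\theta),\qquad \sigma_{n-1}=\frac{2\pi^{n/2}}{\Gamma(n/2)},\qquad (L\Psi)(\theta,s)=\int_{-1}^1\log|s-t|\,\Psi(\theta,t)\,dt,$$ where $d\sigma$ is the surface measure on $S^{n-1}$, and let $\Delta$ be the Laplace operator on $\mathbb R^n$.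 (i) If $n$ is odd, then $R^*\Phi$ is $n-1$ times continuously differentiable in the open unit ball, and for all $x$ with $|x|<1$, $$\varphi(x)=c_n\,(-\Delta)^{(n-1)/2}(R^*\Phi)(x),\qquad c_n=\frac{\pi^{1-n/2}}{2^{n-1}\,\Gamma(n/2)}.$$ (ii) If $n$ is even, then $R^*L\Phi$ is $n$ times continuously differentiable in the open unit ball, and for all $x$ with $|x|<1$, $$\varphi(x)=\tilde c_n\,(-\Delta)^{n/2}(R^*L\Phi)(x),\qquad \tilde c_n=-\frac{\pi^{-n/2}}{2^{n-1}\,\Gamma(n/2)}.$$ -/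

import Mathlib

open MeasureTheory
open scoped NNReal RealInnerProductSpace

noncomputable section

/-- The hyperplane Radon transform of `f` on `ℝⁿ`. The hyperplane `{x | ⟪x, θ⟫ = t}` is the
translate `t θ + θ^⊥`, and it carries the Lebesgue measure of the Euclidean space `θ^⊥`. -/
def radonTransform {n : ℕ} {𝕜 : Type*} [RCLike 𝕜] (f : EuclideanSpace ℝ (Fin n) → 𝕜)
    (θ : Metric.sphere (0 : EuclideanSpace ℝ (Fin n)) 1) (t : ℝ) : 𝕜 :=
  ∫ y : (Submodule.span ℝ {(θ : EuclideanSpace ℝ (Fin n))})ᗮ,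
    f (t • (θ : EuclideanSpace ℝ (Fin n)) + (y : EuclideanSpace ℝ (Fin n))) ∂volume

/-- The area `2 π^(n/2) / Γ(n/2)` of the unit sphere of `ℝⁿ`. -/
def unitSphereArea (n : ℕ) : ℝ :=
  2 * Real.pi ^ ((n : ℝ) / 2) / Real.Gamma ((n : ℝ) / 2)

/-- The dual Radon transform: the average of `Φ` over all hyperplanes through `x`, with respect
to the surface measure of the unit sphere. -/
def dualRadonTransform {n : ℕ} {𝕜 : Type*} [RCLike 𝕜]
    (Φ : Metric.sphere (0 : EuclideanSpace ℝ (Fin n)) 1 → ℝ → 𝕜)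
    (x : EuclideanSpace ℝ (Fin n)) : 𝕜 :=
  (unitSphereArea n)⁻¹ •
    ∫ θ : Metric.sphere (0 : EuclideanSpace ℝ (Fin n)) 1,
      Φ θ ⟪x, (θ : EuclideanSpace ℝ (Fin n))⟫
      ∂(volume : Measure (EuclideanSpace ℝ (Fin n))).toSphere

/-- The logarithmic convolution `(LΦ)(θ, s) = ∫_{-1}^{1} log |s - t| Φ(θ, t) dt`. -/
def logTransform {n : ℕ} {𝕜 : Type*} [RCLike 𝕜]
    (Φ : Metric.sphere (0 : EuclideanSpace ℝ (Fin n)) 1 → ℝ → 𝕜)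
    (θ : Metric.sphere (0 : EuclideanSpace ℝ (Fin n)) 1) (s : ℝ) : 𝕜 :=
  ∫ t in (-1 : ℝ)..1, Real.log |s - t| • Φ θ t

/-- The power `(-Δ)^k` of the (classical) Laplace operator on `ℝⁿ`. -/
def negLaplacianPow {n : ℕ} {𝕜 : Type*} [RCLike 𝕜] (k : ℕ)
    (u : EuclideanSpace ℝ (Fin n) → 𝕜) : EuclideanSpace ℝ (Fin n) → 𝕜 :=
  (fun v : EuclideanSpace ℝ (Fin n) → 𝕜 => -(Laplacian.laplacian v))^[k] u

/-- The extension of `φ` by zero from the closed unit ball to `ℝⁿ`. -/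
def ballExtension {n : ℕ} {𝕜 : Type*} [RCLike 𝕜] (φ : EuclideanSpace ℝ (Fin n) → 𝕜) :
    EuclideanSpace ℝ (Fin n) → 𝕜 :=
  (Metric.closedBall (0 : EuclideanSpace ℝ (Fin n)) 1).indicator φ

end

/-! The theorem reduces to potential theory. For `|x| < 1` the backprojection `R*Φ` is a constant
multiple of the Riesz potential `∫ φ(y) / |x - y| dy`. The reason is that `(s/2)|t|^(s-1)` tends to
the Dirac mass at `0` as `s → 0⁺`, while by rotation invariance and scaling the integral of `|⟪u,
θ⟫|^(s-1)` over the sphere is `sphereMoment n s * |u|^(s-1)`. Integrating `φ(y)` against `(s/2)|⟪x -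
y, θ⟫|^(s-1)` over `y` and `θ`, and taking the limit in both orders, gives
`integral_sphere_radonTransform`. Likewise the sphere integral of `log |⟪u, θ⟫|` is the sphere area
times `log |u|` plus a constant, so `R*LΦ` is the logarithmic potential of `φ` up to an additive
constant (`exists_integral_sphere_logTransform`).

It remains to apply powers of `-Δ`. Away from the origin `-Δ|z|^(-d) = d (n - 2 - d) |z|^(-d-2)`,
and `Δ log |z| = (n - 2)|z|^(-2)`. Starting from `d = 1` in odd dimension, or from the logarithm in
even dimension, the exponent climbs to `n - 2` (for `n = 2` the logarithm is already critical), and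
the last Laplacian produces a multiple of `φ(x)`: `negLaplacianPow_potential_powKernel` and
`negLaplacianPow_potential_logKernel`.

The last derivative is delicate, because its kernel has the non-integrable size `|z|^(-n)`. All
kernels are therefore regularized by replacing `|z|²` with `|z|² + ε²`. Hölder continuity, used
after subtracting a bump multiple of `φ(x)`, makes the regularized top derivatives converge
uniformly on smaller balls (`exists_tendstoUniformlyOn_potential_sliceDeriv`), which gives the
asserted smoothness. The traces of the same derivatives form an approximate identity
(`tendsto_potential_traceKernel`), which identifies the limit. The stated constants follow from
values of the Gamma function. -/

open Filter Topology

set_option linter.unusedSectionVars false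

/-! ### Potentials with weakly singular kernels and their regularizations -/

section Potential

variable {E : Type*} [NormedAddCommGroup E] [InnerProductSpace ℝ E] [FiniteDimensional ℝ E]
  [MeasurableSpace E] [BorelSpace E]
  {𝕜 : Type*} [RCLike 𝕜]
  {V : Type*} [NormedAddCommGroup V] [NormedSpace 𝕜 V] [NormedSpace ℝ V] [IsScalarTower ℝ 𝕜 V]

/-- The potential `∫ f(y) F(x - y, ε) dy` of the density `f` with the kernel `F(·, ε)`. -/
noncomputable def potential (f : E → 𝕜) (F : E × ℝ → V) (ε : ℝ) (x : E) : V :=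
  ∫ y, f y • F (x - y, ε)

/-- The derivative of a kernel `F(z, ε)` in the variable `z`. -/
noncomputable def sliceDeriv (F : E × ℝ → V) (w : E × ℝ) : E →L[ℝ] V :=
  (fderiv ℝ F w).comp (ContinuousLinearMap.inl ℝ E ℝ)

/-- Bounded densities supported in the closed unit ball. -/
structure IsBallDensity (f : E → 𝕜) (M : ℝ) : Prop where
  meas : AEStronglyMeasurable f volume
  bound : ∀ y, ‖f y‖ ≤ M
  supp : ∀ y, 1 < ‖y‖ → f y = 0

/-- Near `z = 0` the kernel is bounded by `‖z‖ ^ (-a)`, uniformly in `ε ∈ [0, 1]`. -/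
def KernelBound (F : E × ℝ → V) (a : ℝ) : Prop :=
  ∃ C, ∀ z ε, z ≠ 0 → ‖z‖ ≤ 2 → 0 ≤ ε → ε ≤ 1 → ‖F (z, ε)‖ ≤ C * ‖z‖ ^ (-a)

/-- The sequence of regularization parameters. -/
noncomputable def regParam (k : ℕ) : ℝ := 1 / ((k : ℝ) + 1)

lemma regParam_pos (k : ℕ) : 0 < regParam k := Nat.one_div_pos_of_nat

lemma regParam_le_one (k : ℕ) : regParam k ≤ 1 := by
  rw [regParam, div_le_one (by positivity)]
  linarith [(Nat.cast_nonneg k : (0 : ℝ) ≤ k)]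

lemma tendsto_regParam : Tendsto regParam atTop (𝓝 0) := tendsto_one_div_add_atTop_nhds_zero_nat

/-- In polar coordinates the radial integrand is `r ^ (n - 1 - a)`, whose exponent exceeds `-1`. -/
lemma integrableOn_norm_rpow_neg [Nontrivial E] {a : ℝ} (ha : a < Module.finrank ℝ E) (R : ℝ) :
    IntegrableOn (fun z : E => ‖z‖ ^ (-a)) (Metric.closedBall 0 R) := by
  refine IntegrableOn.mono_set ?_ (Metric.closedBall_subset_ball (lt_add_one R))
  rw [integrableOn_fun_norm_addHaar volume (f := fun r : ℝ => r ^ (-a))]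
  have h1 : 1 ≤ Module.finrank ℝ E := Module.finrank_pos
  by_cases hR : R + 1 ≤ 0
  · simp [Set.Ioo_eq_empty (not_lt.2 hR)]
  push Not at hR
  have : IntegrableOn (fun r : ℝ => r ^ ((Module.finrank ℝ E : ℝ) - 1 - a)) (Set.Ioo 0 (R + 1)) := by
    rw [← intervalIntegrable_iff_integrableOn_Ioo_of_le hR.le]
    exact intervalIntegral.intervalIntegrable_rpow' (by linarith)
  refine this.congr_fun (fun r hr => ?_) measurableSet_Ioo
  simp only [smul_eq_mul]
  rw [← Real.rpow_natCast, ← Real.rpow_add hr.1, Nat.cast_sub h1]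
  congr 1
  push_cast
  ring

lemma ae_ne_zero [Nontrivial E] : ∀ᵐ z : E, z ≠ 0 := by
  rw [ae_iff]
  simp

/-- The error at `x` is at most `∫ w ‖H k - H₀‖`, which does not depend on `x` and tends to zero by
dominated convergence. -/
lemma tendstoUniformlyOn_integral_smul {H : ℕ → E → V} {H₀ : E → V} {g : E → E → 𝕜} {s : Set E}
    {w b : E → ℝ} (hH : ∀ k, AEStronglyMeasurable (H k)) (hH₀ : AEStronglyMeasurable H₀)
    (hg : ∀ x ∈ s, AEStronglyMeasurable (g x)) (hw : AEStronglyMeasurable w)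
    (hw0 : ∀ z, 0 ≤ w z) (hgw : ∀ x ∈ s, ∀ z, ‖g x z‖ ≤ w z) (hb : Integrable b)
    (hbd : ∀ k, ∀ᵐ z, w z * ‖H k z‖ ≤ b z)
    (hlim : ∀ᵐ z, Tendsto (fun k => H k z) atTop (𝓝 (H₀ z))) :
    TendstoUniformlyOn (fun k x => ∫ z, g x z • H k z) (fun x => ∫ z, g x z • H₀ z) atTop s := by
  have hbd' : ∀ᵐ z, w z * ‖H₀ z‖ ≤ b z := by
    filter_upwards [ae_all_iff.2 hbd, hlim] with z h1 h2
    exact le_of_tendsto (h2.norm.const_mul (w z)) (Eventually.of_forall h1)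
  have key : Tendsto (fun k => ∫ z, w z * ‖H k z - H₀ z‖) atTop (𝓝 (∫ _ : E, (0 : ℝ))) := by
    refine tendsto_integral_of_dominated_convergence (fun z => 2 * b z) (fun k => ?_)
      (hb.const_mul 2) (fun k => ?_) ?_
    · exact hw.mul ((hH k).sub hH₀).norm
    · filter_upwards [hbd k, hbd'] with z h1 h2
      rw [Real.norm_of_nonneg (mul_nonneg (hw0 z) (norm_nonneg _))]
      calc w z * ‖H k z - H₀ z‖ ≤ w z * (‖H k z‖ + ‖H₀ z‖) :=
            mul_le_mul_of_nonneg_left (norm_sub_le _ _) (hw0 z)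
        _ ≤ 2 * b z := by linarith
    · filter_upwards [hlim] with z h
      have := ((h.sub_const (H₀ z)).norm).const_mul (w z)
      simpa using this
  have hint : ∀ x ∈ s, ∀ G : E → V, AEStronglyMeasurable G → (∀ᵐ z, w z * ‖G z‖ ≤ b z) →
      Integrable (fun z => g x z • G z) := by
    intro x hx G hG hGb
    refine hb.mono' ((hg x hx).smul hG) ?_
    filter_upwards [hGb] with z h
    rw [norm_smul]
    exact (mul_le_mul_of_nonneg_right (hgw x hx z) (norm_nonneg _)).trans h
  rw [Metric.tendstoUniformlyOn_iff]
  intro ε hε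
  rw [integral_zero] at key
  filter_upwards [(tendsto_order.1 key).2 ε hε] with k hk x hx
  rw [dist_comm, dist_eq_norm, ← integral_sub (hint x hx _ (hH k) (hbd k)) (hint x hx _ hH₀ hbd')]
  refine lt_of_le_of_lt ?_ hk
  refine norm_integral_le_of_norm_le ?_ (Eventually.of_forall fun z => ?_)
  · refine (hb.const_mul 2).mono' (hw.mul ((hH k).sub hH₀).norm) ?_
    filter_upwards [hbd k, hbd'] with z h1 h2
    rw [Real.norm_of_nonneg (mul_nonneg (hw0 z) (norm_nonneg _))]
    calc w z * ‖H k z - H₀ z‖ ≤ w z * (‖H k z‖ + ‖H₀ z‖) :=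
          mul_le_mul_of_nonneg_left (norm_sub_le _ _) (hw0 z)
      _ ≤ 2 * b z := by linarith
  · rw [← smul_sub, norm_smul]
    exact mul_le_mul_of_nonneg_right (hgw x hx z) (norm_nonneg _)

lemma potential_eq (f : E → 𝕜) (F : E × ℝ → V) (ε : ℝ) (x : E) :
    potential f F ε x = ∫ z, f (x - z) • F (z, ε) := by
  rw [potential, ← integral_sub_left_eq_self _ volume x]
  simp

lemma aestronglyMeasurable_slice [Nontrivial E] {F : E × ℝ → V} (hF : ContinuousOn F {0}ᶜ) (ε : ℝ) :
    AEStronglyMeasurable (fun z : E => F (z, ε)) := by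
  have h : ContinuousOn (fun z : E => F (z, ε)) {0}ᶜ := by
    refine hF.comp (by fun_prop) (fun z hz => ?_)
    simp only [Set.mem_compl_iff, Set.mem_singleton_iff, Prod.mk_eq_zero, not_and] at hz ⊢
    exact fun h => absurd h hz
  have := h.aestronglyMeasurable (μ := volume) (measurableSet_singleton 0).compl
  rwa [Measure.restrict_eq_self_of_ae_mem] at this
  exact ae_ne_zero

lemma tendsto_slice {F : E × ℝ → V} (hF : ContinuousOn F {0}ᶜ) {z : E} (hz : z ≠ 0) :
    Tendsto (fun k => F (z, regParam k)) atTop (𝓝 (F (z, 0))) := by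
  have hz' : ((z, 0) : E × ℝ) ∈ ({0}ᶜ : Set (E × ℝ)) := by simp [hz]
  have h1 : ContinuousAt F (z, 0) := hF.continuousAt (isOpen_compl_singleton.mem_nhds hz')
  exact h1.tendsto.comp (tendsto_const_nhds.prodMk_nhds tendsto_regParam)

lemma IsBallDensity.meas_sub {f : E → 𝕜} {M : ℝ} (hf : IsBallDensity f M) (x : E) :
    AEStronglyMeasurable (fun z => f (x - z)) :=
  hf.meas.comp_measurePreserving (Measure.measurePreserving_sub_left volume x)

lemma IsBallDensity.nonneg {f : E → 𝕜} {M : ℝ} (hf : IsBallDensity f M) : 0 ≤ M :=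
  (norm_nonneg _).trans (hf.bound 0)

lemma IsBallDensity.integrable {f : E → 𝕜} {M : ℝ} (hf : IsBallDensity f M) : Integrable f := by
  have h1 : IntegrableOn f (Metric.closedBall 0 1) :=
    IntegrableOn.of_bound (isCompact_closedBall (0 : E) 1).measure_lt_top hf.meas.restrict M
      (Eventually.of_forall hf.bound)
  refine h1.integrable_of_forall_notMem_eq_zero (fun y hy => hf.supp y ?_)
  simpa using hy

/-- General convergence statement for regularized kernels integrated against weights that vanish
to order `c` at the origin. -/
lemma tendstoUniformlyOn_integral_kernel [Nontrivial E] {F : E × ℝ → V} (hF : ContinuousOn F {0}ᶜ)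
    {a c K : ℝ} (hFb : KernelBound F a) (hac : a - c < Module.finrank ℝ E) {g : E → E → 𝕜} {s : Set E}
    (hg : ∀ x ∈ s, AEStronglyMeasurable (g x)) (hK : 0 ≤ K)
    (hgb : ∀ x ∈ s, ∀ z, ‖g x z‖ ≤ (Metric.closedBall 0 2).indicator (fun z => K * ‖z‖ ^ c) z) :
    TendstoUniformlyOn (fun k x => ∫ z, g x z • F (z, regParam k))
      (fun x => ∫ z, g x z • F (z, 0)) atTop s := by
  obtain ⟨C, hC⟩ := hFb
  have hmeas : ∀ c : ℝ, Measurable fun z : E => ‖z‖ ^ c := fun c => by fun_prop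
  refine tendstoUniformlyOn_integral_smul
    (w := (Metric.closedBall 0 2).indicator (fun z => K * ‖z‖ ^ c))
    (b := (Metric.closedBall 0 2).indicator (fun z => (K * C) * ‖z‖ ^ (-(a - c))))
    (fun k => aestronglyMeasurable_slice hF _) (aestronglyMeasurable_slice hF _) hg
    ?_ ?_ hgb ?_ ?_ ?_
  · exact (((hmeas c).const_mul K).indicator Metric.isClosed_closedBall.measurableSet).aestronglyMeasurable
  · intro z
    exact Set.indicator_nonneg (fun z _ => by positivity) z
  · rw [integrable_indicator_iff Metric.isClosed_closedBall.measurableSet]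
    exact (integrableOn_norm_rpow_neg hac 2).const_mul _
  · intro k
    filter_upwards [ae_ne_zero (E := E)] with z hz
    by_cases h : z ∈ Metric.closedBall (0 : E) 2
    · rw [Set.indicator_of_mem h, Set.indicator_of_mem h]
      have hz2 : ‖z‖ ≤ 2 := by simpa using h
      have hpos : 0 < ‖z‖ := norm_pos_iff.2 hz
      calc K * ‖z‖ ^ c * ‖F (z, regParam k)‖ ≤ K * ‖z‖ ^ c * (C * ‖z‖ ^ (-a)) := by
            gcongr
            exact hC z _ hz hz2 (regParam_pos k).le (regParam_le_one k)
        _ = K * C * (‖z‖ ^ c * ‖z‖ ^ (-a)) := by ring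
        _ = K * C * ‖z‖ ^ (-(a - c)) := by
            rw [← Real.rpow_add hpos]
            congr 2
            ring
    · rw [Set.indicator_of_notMem h, Set.indicator_of_notMem h, zero_mul]
  · filter_upwards [ae_ne_zero (E := E)] with z hz
    exact tendsto_slice hF hz

/-- The case `c = 0` of the preceding lemma: for `‖x‖ < 1` the weight `f (x - z)` is bounded by `M`
and vanishes when `‖z‖ > 2`. -/
lemma tendstoUniformlyOn_potential [Nontrivial E] {f : E → 𝕜} {M : ℝ} (hf : IsBallDensity f M)
    {F : E × ℝ → V} (hF : ContinuousOn F {0}ᶜ) {a : ℝ} (hFb : KernelBound F a)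
    (ha : a < Module.finrank ℝ E) :
    TendstoUniformlyOn (fun k => potential f F (regParam k)) (potential f F 0) atTop
      (Metric.ball 0 1) := by
  have := tendstoUniformlyOn_integral_kernel hF (c := 0) (K := M) hFb (by simpa using ha)
    (g := fun x z => f (x - z)) (s := Metric.ball 0 1) (fun x _ => hf.meas_sub x) hf.nonneg ?_
  · simpa only [← potential_eq] using this
  · intro x hx z
    by_cases h : z ∈ Metric.closedBall (0 : E) 2
    · rw [Set.indicator_of_mem h]
      simpa using hf.bound _
    · rw [Set.indicator_of_notMem h, hf.supp, norm_zero]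
      simp only [mem_closedBall_zero_iff, not_le, mem_ball_zero_iff] at h hx
      have := norm_sub_norm_le z x
      rw [norm_sub_rev]
      linarith

lemma integrable_potential [Nontrivial E] {f : E → 𝕜} {M : ℝ} (hf : IsBallDensity f M)
    {F : E × ℝ → V} (hF : ContinuousOn F {0}ᶜ) {a : ℝ} (hFb : KernelBound F a)
    (ha : a < Module.finrank ℝ E) {ε : ℝ} (hε : 0 ≤ ε) (hε1 : ε ≤ 1) {x : E}
    (hx : x ∈ Metric.ball (0 : E) 1) :
    Integrable (fun y => f y • F (x - y, ε)) := by
  obtain ⟨C, hC⟩ := hFb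
  have h1 : Integrable (fun z => f (x - z) • F (z, ε)) := by
    have hb : Integrable ((Metric.closedBall (0 : E) 2).indicator
        (fun z => (M * C) * ‖z‖ ^ (-a))) := by
      rw [integrable_indicator_iff Metric.isClosed_closedBall.measurableSet]
      exact (integrableOn_norm_rpow_neg ha 2).const_mul _
    refine hb.mono' ((hf.meas_sub x).smul (aestronglyMeasurable_slice hF _)) ?_
    filter_upwards [ae_ne_zero (E := E)] with z hz
    by_cases h : z ∈ Metric.closedBall (0 : E) 2
    · rw [Set.indicator_of_mem h, norm_smul, mul_assoc]
      exact mul_le_mul (hf.bound _) (hC z _ hz (by simpa using h) hε hε1) (norm_nonneg _)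
        hf.nonneg
    · rw [Set.indicator_of_notMem h, hf.supp, zero_smul, norm_zero]
      simp only [mem_closedBall_zero_iff, not_le, mem_ball_zero_iff] at h hx
      have := norm_sub_norm_le z x
      rw [norm_sub_rev]
      linarith
  simpa using h1.comp_sub_left x

end Potential

/-! ### Differentiation of potentials, up to the critical order -/

section PotentialDeriv

open scoped ContDiff

variable {E : Type*} [NormedAddCommGroup E] [InnerProductSpace ℝ E] [FiniteDimensional ℝ E]
  [MeasurableSpace E] [BorelSpace E]
  {𝕜 : Type*} [RCLike 𝕜]
  {V : Type*} [NormedAddCommGroup V] [NormedSpace 𝕜 V] [NormedSpace ℝ V] [IsScalarTower ℝ 𝕜 V]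

lemma mk_ne_zero_of_pos (z : E) {ε : ℝ} (hε : 0 < ε) : ((z, ε) : E × ℝ) ∈ ({0}ᶜ : Set (E × ℝ)) := by
  simp [hε.ne']

lemma hasFDerivAt_slice {F : E × ℝ → V} (hF : ContDiffOn ℝ ∞ F {0}ᶜ) {z : E} {ε : ℝ}
    (h : ((z, ε) : E × ℝ) ∈ ({0}ᶜ : Set (E × ℝ))) :
    HasFDerivAt (fun z => F (z, ε)) (sliceDeriv F (z, ε)) z := by
  have h1 : DifferentiableAt ℝ F (z, ε) :=
    (hF.contDiffAt (isOpen_compl_singleton.mem_nhds h)).differentiableAt (by simp)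
  exact h1.hasFDerivAt.comp z (hasFDerivAt_prodMk_left z ε)

lemma contDiffOn_sliceDeriv {F : E × ℝ → V} (hF : ContDiffOn ℝ ∞ F {0}ᶜ) :
    ContDiffOn ℝ ∞ (sliceDeriv F) {0}ᶜ :=
  (hF.fderiv_of_isOpen isOpen_compl_singleton (by simp)).clm_comp contDiffOn_const

lemma continuous_slice_of_pos {F : E × ℝ → V} (hF : ContinuousOn F {0}ᶜ) {ε : ℝ} (hε : 0 < ε) :
    Continuous (fun z => F (z, ε)) := by
  rw [← continuousOn_univ]
  exact hF.comp (by fun_prop) (fun z _ => mk_ne_zero_of_pos z hε)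

lemma integrable_density_smul {f : E → 𝕜} {M : ℝ} (hf : IsBallDensity f M) {G : E → V}
    (hG : Continuous G) : Integrable (fun y => f y • G y) := by
  have h1 : IntegrableOn (fun y => f y • G y) (Metric.closedBall 0 1) :=
    hf.integrable.integrableOn.smul_continuousOn hG.continuousOn (isCompact_closedBall _ _)
  refine h1.integrable_of_forall_notMem_eq_zero (fun y hy => ?_)
  rw [hf.supp y (by simpa using hy), zero_smul]

/-- For `ε > 0` the slice of the kernel is smooth on all of `E`, so differentiation under the
integral meets no singularity. Every statement at `ε = 0` is obtained as a limit of this one. -/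
lemma hasFDerivAt_potential_of_pos {f : E → 𝕜} {M : ℝ} (hf : IsBallDensity f M) {F : E × ℝ → V}
    (hF : ContDiffOn ℝ ∞ F {0}ᶜ) {ε : ℝ} (hε : 0 < ε) (x : E) :
    HasFDerivAt (potential f F ε) (potential f (sliceDeriv F) ε x) x := by
  have hc := continuous_slice_of_pos hF.continuousOn hε
  have hc' := continuous_slice_of_pos (contDiffOn_sliceDeriv hF).continuousOn hε
  obtain ⟨B, hB⟩ := (isCompact_closedBall (0 : E) (‖x‖ + 2)).exists_bound_of_continuousOn
    hc'.continuousOn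
  refine hasFDerivAt_integral_of_dominated_of_fderiv_le (𝕜 := ℝ)
    (F' := fun x y => f y • sliceDeriv F (x - y, ε)) (bound := fun y => ‖f y‖ * B)
    (Metric.ball_mem_nhds x one_pos) (Eventually.of_forall fun x' => ?_) ?_ ?_ ?_ ?_ ?_
  · exact (integrable_density_smul hf (hc.comp (by fun_prop : Continuous fun y => x' - y))).1
  · exact (integrable_density_smul hf (hc.comp (by fun_prop : Continuous fun y => x - y)))
  · exact (integrable_density_smul hf (hc'.comp (by fun_prop : Continuous fun y => x - y))).1
  · refine Eventually.of_forall fun y x' hx' => ?_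
    rw [norm_smul]
    by_cases hy : 1 < ‖y‖
    · simp [hf.supp y hy]
    · refine mul_le_mul_of_nonneg_left (hB _ ?_) (norm_nonneg _)
      rw [mem_closedBall_zero_iff]
      rw [Metric.mem_ball, dist_eq_norm] at hx'
      push Not at hy
      calc ‖x' - y‖ = ‖x + (x' - x) - y‖ := by congr 1; abel
        _ ≤ ‖x‖ + ‖x' - x‖ + ‖y‖ := (norm_sub_le _ _).trans (by gcongr; exact norm_add_le _ _)
        _ ≤ ‖x‖ + 2 := by linarith
  · exact hf.integrable.norm.mul_const B
  · refine Eventually.of_forall fun y x' _ => ?_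
    have h1 := hasFDerivAt_slice hF (mk_ne_zero_of_pos (x' - y) hε)
    have h2 : HasFDerivAt (fun x' => F (x' - y, ε)) (sliceDeriv F (x' - y, ε)) x' := by
      simpa [Function.comp_def] using h1.comp x' ((hasFDerivAt_id x').sub_const y)
    exact h2.const_smul (f y)

lemma continuous_potential_of_pos {f : E → 𝕜} {M : ℝ} (hf : IsBallDensity f M) {F : E × ℝ → V}
    (hF : ContDiffOn ℝ ∞ F {0}ᶜ) {ε : ℝ} (hε : 0 < ε) : Continuous (potential f F ε) :=
  continuous_iff_continuousAt.2 fun x => (hasFDerivAt_potential_of_pos hf hF hε x).continuousAt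

/-- Differentiation of a potential whose differentiated kernel is still integrable. -/
lemma hasFDerivAt_potential [Nontrivial E] {f : E → 𝕜} {M : ℝ} (hf : IsBallDensity f M)
    {F : E × ℝ → V} (hF : ContDiffOn ℝ ∞ F {0}ᶜ) {a b : ℝ} (hFa : KernelBound F a)
    (ha : a < Module.finrank ℝ E) (hFb : KernelBound (sliceDeriv F) b)
    (hb : b < Module.finrank ℝ E) {x : E} (hx : x ∈ Metric.ball (0 : E) 1) :
    HasFDerivAt (potential f F 0) (potential f (sliceDeriv F) 0 x) x :=
  hasFDerivAt_of_tendstoUniformlyOn (f := fun k => potential f F (regParam k)) Metric.isOpen_ball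
    (tendstoUniformlyOn_potential hf (contDiffOn_sliceDeriv hF).continuousOn hFb hb)
    (fun k _ _ => hasFDerivAt_potential_of_pos hf hF (regParam_pos k) _)
    (fun _ hx => (tendstoUniformlyOn_potential hf hF.continuousOn hFa ha).tendsto_at hx) hx

/-- The integral of a singular kernel against a bump converges, through integration by parts. -/
lemma tendsto_integral_bump_smul_sliceDeriv [Nontrivial E] [CompleteSpace V]
    {F : E × ℝ → V} (hF : ContDiffOn ℝ ∞ F {0}ᶜ) {a : ℝ} (hFa : KernelBound F a)
    (ha : a < Module.finrank ℝ E) (χ : ContDiffBump (0 : E)) (hχ : χ.rOut ≤ 2) :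
    ∃ L, Tendsto (fun k => ∫ z, χ z • sliceDeriv F (z, regParam k)) atTop (𝓝 L) := by
  have hχd : ContDiff ℝ 1 χ := χ.contDiff
  have hχc : Continuous (fderiv ℝ χ) := hχd.continuous_fderiv (by simp)
  have hχs : HasCompactSupport χ := χ.hasCompactSupport
  have hχs' : HasCompactSupport (fderiv ℝ χ) := hχs.fderiv ℝ
  obtain ⟨B, hB⟩ := hχs'.exists_bound_of_continuous hχc
  have hB0 : 0 ≤ B := (norm_nonneg _).trans (hB 0)
  have hzero : ∀ z : E, 2 < ‖z‖ → fderiv ℝ χ z = 0 := by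
    intro z hz
    have : z ∉ tsupport χ := by
      rw [χ.tsupport_eq]
      simp only [mem_closedBall_zero_iff, not_le]
      linarith
    have h2 := support_fderiv_subset ℝ (f := χ)
    by_contra hne
    exact this (h2 hne)
  have hparts : ∀ k, ∫ z, χ z • sliceDeriv F (z, regParam k) =
      - ∫ z, (fderiv ℝ χ z).smulRight (F (z, regParam k)) := by
    intro k
    have hε := regParam_pos k
    have hc := continuous_slice_of_pos hF.continuousOn hε
    have hc' := continuous_slice_of_pos (contDiffOn_sliceDeriv hF).continuousOn hε
    have hd : ∀ z, HasFDerivAt (fun z => F (z, regParam k)) (sliceDeriv F (z, regParam k)) z :=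
      fun z => hasFDerivAt_slice hF (mk_ne_zero_of_pos z hε)
    have i1 : Integrable fun z => χ z • sliceDeriv F (z, regParam k) :=
      (χ.continuous.smul hc').integrable_of_hasCompactSupport hχs.smul_right
    have i2 : Integrable fun z => (fderiv ℝ χ z).smulRight (F (z, regParam k)) := by
      refine Continuous.integrable_of_hasCompactSupport ?_ ?_
      · exact (ContinuousLinearMap.smulRightL ℝ E V).continuous₂.comp (hχc.prodMk hc)
      · refine hχs'.mono fun z hz => ?_
        contrapose hz
        simp only [Function.mem_support, not_not] at hz ⊢
        ext v
        simp [hz]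
    ext v
    rw [ContinuousLinearMap.integral_apply i1, neg_apply,
      ContinuousLinearMap.integral_apply i2]
    have h3 := integral_smul_fderiv_eq_neg_fderiv_smul_of_integrable (μ := (volume : Measure E))
      (f := χ) (g := fun z => F (z, regParam k)) (v := v) ?_ ?_ ?_
      (fun z _ => hχd.differentiable (by simp) z) (fun z _ => (hd z).differentiableAt)
    · simpa [fun z => (hd z).fderiv] using h3
    · exact (ContinuousLinearMap.apply ℝ V v).integrable_comp i2
    · simp only [fun z => (hd z).fderiv]
      exact (ContinuousLinearMap.apply ℝ V v).integrable_comp i1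
    · exact (χ.continuous.smul hc).integrable_of_hasCompactSupport hχs.smul_right
  obtain ⟨C, hC⟩ := hFa
  refine ⟨- ∫ z, (fderiv ℝ χ z).smulRight (F (z, 0)), ?_⟩
  -- The derivative now falls on the bump, so only `F` itself is left, and its singularity of order
  -- `a < dim E` is integrable uniformly in `ε`.
  simp only [hparts]
  refine Tendsto.neg ?_
  refine tendsto_integral_of_dominated_convergence
    ((Metric.closedBall (0 : E) 2).indicator fun z => (B * C) * ‖z‖ ^ (-a)) (fun k => ?_) ?_
    (fun k => ?_) ?_
  · exact ((ContinuousLinearMap.smulRightL ℝ E V).continuous₂).comp_aestronglyMeasurable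
      (hχc.aestronglyMeasurable.prodMk (aestronglyMeasurable_slice hF.continuousOn _))
  · rw [integrable_indicator_iff Metric.isClosed_closedBall.measurableSet]
    exact (integrableOn_norm_rpow_neg ha 2).const_mul _
  · filter_upwards [ae_ne_zero (E := E)] with z hz
    rw [ContinuousLinearMap.norm_smulRight_apply]
    by_cases h : z ∈ Metric.closedBall (0 : E) 2
    · rw [Set.indicator_of_mem h, mul_assoc]
      exact mul_le_mul (hB z) (hC z _ hz (by simpa using h) (regParam_pos k).le (regParam_le_one k))
        (norm_nonneg _) hB0
    · rw [Set.indicator_of_notMem h, hzero z (by simpa using h), norm_zero, zero_mul]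
  · filter_upwards [ae_ne_zero (E := E)] with z hz
    have := tendsto_slice hF.continuousOn hz
    exact ((ContinuousLinearMap.smulRightL ℝ E V (fderiv ℝ χ z)).continuous.tendsto _).comp this

/-- The top order derivatives of the regularized potentials of a Hölder density converge uniformly
on smaller balls. -/
lemma exists_tendstoUniformlyOn_potential_sliceDeriv [Nontrivial E] [CompleteSpace V]
    {f : E → 𝕜} {M : ℝ} (hf : IsBallDensity f M) {A lam : ℝ} (hlam : 0 < lam)
    (hfA : ∀ x ∈ Metric.ball (0 : E) 1, ∀ y ∈ Metric.ball (0 : E) 1,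
      ‖f x - f y‖ ≤ A * ‖x - y‖ ^ lam)
    {F : E × ℝ → V} (hF : ContDiffOn ℝ ∞ F {0}ᶜ) {a : ℝ} (hFa : KernelBound F a)
    (ha : a < Module.finrank ℝ E) (hFb : KernelBound (sliceDeriv F) (Module.finrank ℝ E))
    {ρ : ℝ} (hρ0 : 0 ≤ ρ) (hρ : ρ < 1) :
    ∃ J, TendstoUniformlyOn (fun k => potential f (sliceDeriv F) (regParam k)) J atTop
      (Metric.ball (0 : E) ρ) := by
  set r := 1 - ρ with hr
  have hr0 : 0 < r := by linarith
  -- For `‖x‖ < ρ` and `‖z‖ ≤ r / 2` the point `x - z` stays in the open unit ball, where the Hölder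
  -- bound is available.
  let χ : ContDiffBump (0 : E) := ⟨r / 2, r, by linarith, by linarith⟩
  obtain ⟨L, hL⟩ := tendsto_integral_bump_smul_sliceDeriv hF hFa ha χ
    (by change r ≤ 2; linarith)
  have hF' := (contDiffOn_sliceDeriv hF).continuousOn
  -- Subtracting `χ z • f x` makes the weight `O(‖z‖ ^ lam)` at the origin. The compensating term is
  -- `f x` times an integral independent of `x`, which converges to `L`.
  have hsplit : ∀ k x, potential f (sliceDeriv F) (regParam k) x =
      (∫ z, (f (x - z) - χ z • f x) • sliceDeriv F (z, regParam k)) +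
        f x • ∫ z, χ z • sliceDeriv F (z, regParam k) := by
    intro k x
    have hc' := continuous_slice_of_pos hF' (regParam_pos k)
    have i1 : Integrable fun z => f (x - z) • sliceDeriv F (z, regParam k) := by
      simpa using (integrable_density_smul hf
        (hc'.comp (by fun_prop : Continuous fun y => x - y))).comp_sub_left x
    have i2 : Integrable fun z => χ z • sliceDeriv F (z, regParam k) :=
      (χ.continuous.smul hc').integrable_of_hasCompactSupport χ.hasCompactSupport.smul_right
    rw [potential_eq, ← integral_smul, ← integral_add]
    · refine integral_congr_ae (Eventually.of_forall fun z => ?_)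
      simp only
      rw [sub_smul, smul_assoc, smul_comm (f x), sub_add_cancel]
    · have := i1.sub (i2.smul (f x))
      refine this.congr (Eventually.of_forall fun z => ?_)
      simp only [Pi.sub_apply, Pi.smul_apply]
      rw [sub_smul, smul_assoc, smul_comm (f x)]
    · exact i2.smul (f x)
  have hA0 : 0 ≤ |A| := abs_nonneg A
  -- The effective singularity has order `dim E - lam`, which is integrable. In `K`, the summand
  -- `|A|` serves `‖z‖ ≤ r / 2`; the other one serves larger `z`, where the weight is at most `2 *
  -- M` and `(r / 2) ^ (-lam) * ‖z‖ ^ lam ≥ 1`.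
  have h1 := tendstoUniformlyOn_integral_kernel hF' (c := lam)
    (K := |A| + 2 * M * (r / 2) ^ (-lam)) hFb (by linarith)
    (g := fun x z => f (x - z) - χ z • f x) (s := Metric.ball 0 ρ)
    (fun x _ => (hf.meas_sub x).sub (χ.continuous.aestronglyMeasurable.smul_const _)) ?_ ?_
  · refine ⟨_, (h1.add (f' := fun k x => f x • ∫ z, χ z • sliceDeriv F (z, regParam k))
      (g' := fun x => f x • L) ?_).congr (Eventually.of_forall fun k x _ => (hsplit k x).symm)⟩
    rw [Metric.tendstoUniformlyOn_iff]
    intro e he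
    have hM := hf.nonneg
    filter_upwards [Metric.tendsto_nhds.1 hL (e / (M + 1)) (by positivity)] with k hk x _
    rw [dist_comm, dist_eq_norm, ← smul_sub, norm_smul]
    rw [dist_eq_norm, lt_div_iff₀ (by positivity)] at hk
    calc _ ≤ (M + 1) * ‖(∫ z, χ z • sliceDeriv F (z, regParam k)) - L‖ := ?_
      _ < e := ?_
    · exact mul_le_mul_of_nonneg_right ((hf.bound x).trans (lt_add_one M).le) (norm_nonneg _)
    · rw [mul_comm]; exact hk
  · have hM := hf.nonneg
    positivity
  · intro x hx z
    have hM := hf.nonneg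
    rw [mem_ball_zero_iff] at hx
    by_cases hz2 : z ∈ Metric.closedBall (0 : E) 2
    · rw [Set.indicator_of_mem hz2]
      by_cases hz : ‖z‖ ≤ r / 2
      · have : χ z = 1 := χ.one_of_mem_closedBall (by simpa using hz)
        rw [this, one_smul]
        have hxz := norm_sub_le x z
        calc ‖f (x - z) - f x‖ ≤ A * ‖(x - z) - x‖ ^ lam :=
              hfA _ (by rw [mem_ball_zero_iff]; linarith) _ (by rw [mem_ball_zero_iff]; linarith)
          _ = A * ‖z‖ ^ lam := by simp
          _ ≤ (|A| + 2 * M * (r / 2) ^ (-lam)) * ‖z‖ ^ lam := by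
              gcongr
              have : 0 ≤ 2 * M * (r / 2) ^ (-lam) := by positivity
              linarith [le_abs_self A]
      · push Not at hz
        have e1 : ‖f (x - z) - χ z • f x‖ ≤ 2 * M := by
          refine (norm_sub_le _ _).trans ?_
          rw [norm_smul, Real.norm_of_nonneg χ.nonneg]
          have := mul_le_mul (χ.le_one (x := z)) (hf.bound x) (norm_nonneg _) zero_le_one
          linarith [hf.bound (x - z)]
        have e2 : 1 ≤ (r / 2) ^ (-lam) * ‖z‖ ^ lam := by
          rw [Real.rpow_neg (by positivity), ← div_eq_inv_mul, one_le_div (by positivity)]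
          exact Real.rpow_le_rpow (by positivity) hz.le hlam.le
        have e3 : 0 ≤ |A| * ‖z‖ ^ lam := by positivity
        nlinarith
    · rw [Set.indicator_of_notMem hz2]
      simp only [mem_closedBall_zero_iff, not_le] at hz2
      have : χ z = 0 := χ.zero_of_le_dist (by change r ≤ _; simp; linarith)
      rw [this, zero_smul, sub_zero, hf.supp, norm_zero]
      have := norm_sub_norm_le z x
      rw [norm_sub_rev]
      linarith

end PotentialDeriv

/-! ### Homogeneous kernels and interior regularity -/

section Homogeneous

open scoped ContDiff

variable {E : Type*} [NormedAddCommGroup E] [InnerProductSpace ℝ E] [FiniteDimensional ℝ E]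
  [MeasurableSpace E] [BorelSpace E]

/-- Smooth kernels on `(E × ℝ) \ {0}` that are homogeneous of degree `-d`. -/
structure IsHomogeneousKernel {V : Type*} [NormedAddCommGroup V] [NormedSpace ℝ V]
    (F : E × ℝ → V) (d : ℕ) : Prop where
  smooth : ContDiffOn ℝ ∞ F {0}ᶜ
  smul_eq : ∀ t : ℝ, 0 < t → ∀ w, w ≠ 0 → t ^ d • F (t • w) = F w

/-- Differentiating the scaling identity in `w` brings out one more factor `t`. -/
lemma IsHomogeneousKernel.sliceDeriv {V : Type*} [NormedAddCommGroup V] [NormedSpace ℝ V]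
    {F : E × ℝ → V} {d : ℕ} (hF : IsHomogeneousKernel F d) :
    IsHomogeneousKernel (sliceDeriv F) (d + 1) where
  smooth := contDiffOn_sliceDeriv hF.smooth
  smul_eq t ht w hw := by
    have h1 : (fun w => t ^ d • F (t • w)) =ᶠ[𝓝 w] F := by
      filter_upwards [isOpen_compl_singleton.mem_nhds hw] with w hw
      exact hF.smul_eq t ht w hw
    have h2 := h1.fderiv_eq (𝕜 := ℝ)
    have h3 : fderiv ℝ (fun w => t ^ d • F (t • w)) w = t ^ d • t • fderiv ℝ F (t • w) := by
      rw [← fderiv_comp_smul]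
      exact congrFun (fderiv_const_smul_field (𝕜 := ℝ) (f := fun w => F (t • w)) (t ^ d)) w
    rw [_root_.sliceDeriv, _root_.sliceDeriv, ← h2, h3]
    ext v
    simp [pow_succ, mul_smul]

/-- Treating `ε` as an extra coordinate pays off here: rescaling to the compact unit sphere of `E ×
ℝ` bounds `F w` by a multiple of `‖w‖ ^ (-d)`, and `‖z‖ ≤ ‖(z, ε)‖` makes the bound uniform in `ε`.
-/
lemma IsHomogeneousKernel.kernelBound {V : Type*} [NormedAddCommGroup V] [NormedSpace ℝ V]
    {F : E × ℝ → V} {d : ℕ} (hF : IsHomogeneousKernel F d) : KernelBound F d := by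
  have hs : ContinuousOn F (Metric.sphere 0 1) := by
    refine hF.smooth.continuousOn.mono fun w hw => ?_
    rintro rfl
    simp at hw
  obtain ⟨C, hC⟩ := (isCompact_sphere (0 : E × ℝ) 1).exists_bound_of_continuousOn hs
  refine ⟨|C|, fun z ε hz _ _ _ => ?_⟩
  set w : E × ℝ := (z, ε) with hw
  have hw0 : w ≠ 0 := by simp [hw, hz]
  have hpos : 0 < ‖w‖ := norm_pos_iff.2 hw0
  have hz' : 0 < ‖z‖ := norm_pos_iff.2 hz
  have hle : ‖z‖ ≤ ‖w‖ := norm_fst_le w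
  have h1 := hF.smul_eq ‖w‖⁻¹ (inv_pos.2 hpos) w hw0
  rw [← h1, norm_smul, norm_pow, norm_inv, norm_norm, Real.rpow_neg hz'.le, Real.rpow_natCast,
    inv_pow, mul_comm]
  gcongr
  exact (hC _ (by simp [norm_smul, hpos.ne'])).trans (le_abs_self C)

lemma KernelBound.mono {V : Type*} [NormedAddCommGroup V]
    {F : E × ℝ → V} {a b : ℝ} (hF : KernelBound F a) (hab : a ≤ b) : KernelBound F b := by
  obtain ⟨C, hC⟩ := hF
  refine ⟨|C| * 2 ^ (b - a), fun z ε hz hz2 h0 h1 => (hC z ε hz hz2 h0 h1).trans ?_⟩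
  have hz' : 0 < ‖z‖ := norm_pos_iff.2 hz
  have : ‖z‖ ^ (-a) = ‖z‖ ^ (b - a) * ‖z‖ ^ (-b) := by
    rw [← Real.rpow_add hz']
    congr 1
    ring
  rw [this, mul_assoc]
  have h3 : ‖z‖ ^ (b - a) ≤ 2 ^ (b - a) := Real.rpow_le_rpow hz'.le hz2 (by linarith)
  gcongr
  exact le_abs_self C

universe u

variable {𝕜 : Type u} [RCLike 𝕜]

/-- Differentiability is local, so uniform convergence of the derivatives on each smaller ball is
enough; the local limits are continuous and must agree with `fderiv ℝ U`. -/
lemma hasFDerivAt_of_tendstoUniformlyOn_ball {V : Type*} [NormedAddCommGroup V] [NormedSpace ℝ V]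
    {u : ℕ → E → V} {u' : ℕ → E → E →L[ℝ] V} {U : E → V}
    (hu : ∀ k x, HasFDerivAt (u k) (u' k x) x) (hc : ∀ k, Continuous (u' k))
    (hU : ∀ x ∈ Metric.ball (0 : E) 1, Tendsto (fun k => u k x) atTop (𝓝 (U x)))
    (hJ : ∀ ρ : ℝ, 0 ≤ ρ → ρ < 1 → ∃ J, TendstoUniformlyOn u' J atTop (Metric.ball (0 : E) ρ)) :
    ContDiffOn ℝ 1 U (Metric.ball 0 1) ∧
      ∀ x ∈ Metric.ball (0 : E) 1, Tendsto (fun k => u' k x) atTop (𝓝 (fderiv ℝ U x)) := by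
  have key : ∀ x ∈ Metric.ball (0 : E) 1, ∃ ρ : ℝ, x ∈ Metric.ball (0 : E) ρ ∧ ∃ J,
      TendstoUniformlyOn u' J atTop (Metric.ball (0 : E) ρ) ∧
      ∀ y ∈ Metric.ball (0 : E) ρ, HasFDerivAt U (J y) y := by
    intro x hx
    rw [mem_ball_zero_iff] at hx
    obtain ⟨ρ, h1, h2⟩ := exists_between hx
    obtain ⟨J, hJ⟩ := hJ ρ ((norm_nonneg _).trans h1.le) h2
    refine ⟨ρ, by simpa using h1, J, hJ, fun y hy => ?_⟩
    exact hasFDerivAt_of_tendstoUniformlyOn Metric.isOpen_ball hJ (fun k x _ => hu k x)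
      (fun x hx => hU x (Metric.ball_subset_ball h2.le hx)) hy
  constructor
  · have h1 : ContDiffOn ℝ (0 + 1) U (Metric.ball 0 1) := by
      rw [contDiffOn_succ_iff_fderiv_of_isOpen Metric.isOpen_ball]
      refine ⟨fun x hx => ?_, by simp, ?_⟩
      · obtain ⟨ρ, hxρ, J, -, h⟩ := key x hx
        exact (h x hxρ).differentiableAt.differentiableWithinAt
      · rw [contDiffOn_zero]
        intro x hx
        obtain ⟨ρ, hxρ, J, hJ, h⟩ := key x hx
        have hcJ : ContinuousOn J (Metric.ball 0 ρ) :=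
          hJ.continuousOn (Frequently.of_forall fun k => (hc k).continuousOn)
        have : ContinuousAt J x := hcJ.continuousAt (Metric.isOpen_ball.mem_nhds hxρ)
        refine (this.congr ?_).continuousWithinAt
        filter_upwards [Metric.isOpen_ball.mem_nhds hxρ] with y hy
        exact (h y hy).fderiv.symm
    simpa using h1
  · intro x hx
    obtain ⟨ρ, hxρ, J, hJ, h⟩ := key x hx
    rw [(h x hxρ).fderiv]
    exact hJ.tendsto_at hxρ

/-- Interior regularity at the critical order. -/
lemma contDiffOn_one_potential [Nontrivial E] {f : E → 𝕜} {M : ℝ} (hf : IsBallDensity f M)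
    {A lam : ℝ} (hlam : 0 < lam)
    (hfA : ∀ x ∈ Metric.ball (0 : E) 1, ∀ y ∈ Metric.ball (0 : E) 1,
      ‖f x - f y‖ ≤ A * ‖x - y‖ ^ lam)
    {V : Type*} [NormedAddCommGroup V] [NormedSpace 𝕜 V] [NormedSpace ℝ V] [IsScalarTower ℝ 𝕜 V]
    [CompleteSpace V] {F : E × ℝ → V} (hF : ContDiffOn ℝ ∞ F {0}ᶜ) {a : ℝ} (hFa : KernelBound F a)
    (ha : a < Module.finrank ℝ E) (hFb : KernelBound (sliceDeriv F) (Module.finrank ℝ E)) :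
    ContDiffOn ℝ 1 (potential f F 0) (Metric.ball 0 1) ∧
      ∀ x ∈ Metric.ball (0 : E) 1, Tendsto (fun k => potential f (sliceDeriv F) (regParam k) x)
        atTop (𝓝 (fderiv ℝ (potential f F 0) x)) :=
  hasFDerivAt_of_tendstoUniformlyOn_ball (u := fun k => potential f F (regParam k))
    (fun k x => hasFDerivAt_potential_of_pos hf hF (regParam_pos k) x)
    (fun k => continuous_potential_of_pos hf (contDiffOn_sliceDeriv hF) (regParam_pos k))
    (fun _ hx => (tendstoUniformlyOn_potential hf hF.continuousOn hFa ha).tendsto_at hx)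
    (fun _ h0 h1 => exists_tendstoUniformlyOn_potential_sliceDeriv hf hlam hfA hF hFa ha hFb h0 h1)

/-- Interior regularity: the potential of a Hölder density with a kernel of degree `-d` has
`dim E - d` continuous derivatives in the open unit ball. -/
theorem contDiffOn_potential {E : Type} [NormedAddCommGroup E] [InnerProductSpace ℝ E]
    [FiniteDimensional ℝ E] [MeasurableSpace E] [BorelSpace E] [Nontrivial E]
    {f : E → 𝕜} {M : ℝ} (hf : IsBallDensity f M)
    {A lam : ℝ} (hlam : 0 < lam)
    (hfA : ∀ x ∈ Metric.ball (0 : E) 1, ∀ y ∈ Metric.ball (0 : E) 1,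
      ‖f x - f y‖ ≤ A * ‖x - y‖ ^ lam) (m : ℕ) :
    ∀ {V : Type u} [NormedAddCommGroup V] [NormedSpace 𝕜 V] [NormedSpace ℝ V] [IsScalarTower ℝ 𝕜 V]
    [CompleteSpace V] {F : E × ℝ → V} {d : ℕ}, IsHomogeneousKernel F d →
    d + (m + 1) = Module.finrank ℝ E →
    ContDiffOn ℝ ((m + 1 : ℕ) : WithTop ℕ∞) (potential f F 0) (Metric.ball 0 1) := by
  -- The target `V` is quantified after `m`, because each derivative replaces it by `E →L[ℝ] V`;
  -- taking `E : Type` keeps this space in universe `u`. Only the base case has a critical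
  -- derivative and needs the Hölder condition.
  induction m with
  | zero =>
    intro V _ _ _ _ _ F d hF hd
    have hb := hF.sliceDeriv.kernelBound
    simpa using (contDiffOn_one_potential hf hlam hfA hF.smooth hF.kernelBound
      (by rw [← hd]; push_cast; linarith) (by rw [← hd]; simpa using hb)).1
  | succ m ih =>
    intro V _ _ _ _ _ F d hF hd
    have hd1 : (d : ℝ) < Module.finrank ℝ E := by
      rw [← hd]
      push_cast
      linarith [(Nat.cast_nonneg m : (0 : ℝ) ≤ m)]
    have hd2 : ((d + 1 : ℕ) : ℝ) < Module.finrank ℝ E := by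
      rw [← hd]
      push_cast
      linarith [(Nat.cast_nonneg m : (0 : ℝ) ≤ m)]
    have hderiv : ∀ x ∈ Metric.ball (0 : E) 1,
        HasFDerivAt (potential f F 0) (potential f (sliceDeriv F) 0 x) x := fun x hx =>
      hasFDerivAt_potential hf hF.smooth hF.kernelBound hd1 hF.sliceDeriv.kernelBound hd2 hx
    rw [Nat.cast_succ, contDiffOn_succ_iff_fderiv_of_isOpen Metric.isOpen_ball]
    refine ⟨fun x hx => (hderiv x hx).differentiableAt.differentiableWithinAt, ?_, ?_⟩
    · intro h
      exact absurd h (by simp)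
    · exact (ih hF.sliceDeriv (by omega)).congr fun x hx => (hderiv x hx).fderiv

end Homogeneous

/-! ### The regularized power, logarithmic and gradient kernels -/

section RadialKernels

open scoped ContDiff

variable {E : Type*} [NormedAddCommGroup E] [InnerProductSpace ℝ E] [FiniteDimensional ℝ E]
  [MeasurableSpace E] [BorelSpace E]

/-- The squared Euclidean length of `(z, ε)`. -/
noncomputable def sqLength (w : E × ℝ) : ℝ := ‖w.1‖ ^ 2 + w.2 ^ 2

lemma sqLength_pos {w : E × ℝ} (hw : w ≠ 0) : 0 < sqLength w := by
  obtain ⟨z, ε⟩ := w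
  simp only [ne_eq, Prod.mk_eq_zero, not_and_or] at hw
  unfold sqLength
  rcases hw with h | h
  · have := norm_pos_iff.2 h
    positivity
  · have := sq_pos_of_ne_zero h
    positivity

lemma sqLength_smul (t : ℝ) (w : E × ℝ) : sqLength (t • w) = t ^ 2 * sqLength w := by
  simp [sqLength, norm_smul, mul_pow]
  ring

lemma contDiff_sqLength : ContDiff ℝ ∞ (sqLength : E × ℝ → ℝ) :=
  (contDiff_fst.norm_sq ℝ).add (contDiff_snd.pow 2)

lemma hasFDerivAt_sqLength (z : E) (ε : ℝ) :
    HasFDerivAt (fun z : E => sqLength (z, ε)) (2 • innerSL ℝ z) z :=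
  (hasStrictFDerivAt_norm_sq z).hasFDerivAt.add_const (ε ^ 2)

variable (𝕜 : Type*) [RCLike 𝕜]

/-- The regularization `(‖z‖² + ε²)^(-d/2)` of `‖z‖^(-d)`. -/
noncomputable def powKernel (d : ℕ) (w : E × ℝ) : 𝕜 := ((sqLength w ^ (-(d : ℝ) / 2) : ℝ) : 𝕜)

/-- The regularization `log (‖z‖² + ε²) / 2` of `log ‖z‖`. -/
noncomputable def logKernel (w : E × ℝ) : 𝕜 := ((Real.log (sqLength w) / 2 : ℝ) : 𝕜)

/-- The kernel `(‖z‖² + ε²)^(-(d+2)/2) z`, as a linear form. -/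
noncomputable def gradKernel (d : ℕ) (w : E × ℝ) : E →L[ℝ] 𝕜 :=
  (sqLength w ^ (-((d : ℝ) + 2) / 2)) • (RCLike.ofRealCLM : ℝ →L[ℝ] 𝕜).comp (innerSL ℝ w.1)

variable {𝕜}

lemma contDiffOn_sqLength_rpow (p : ℝ) :
    ContDiffOn ℝ ∞ (fun w : E × ℝ => sqLength w ^ p) {0}ᶜ :=
  contDiff_sqLength.contDiffOn.rpow_const_of_ne fun _ hw => (sqLength_pos hw).ne'

lemma isHomogeneousKernel_powKernel (d : ℕ) :
    IsHomogeneousKernel (powKernel 𝕜 d : E × ℝ → 𝕜) d where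
  smooth := (RCLike.ofRealCLM : ℝ →L[ℝ] 𝕜).contDiff.comp_contDiffOn (contDiffOn_sqLength_rpow _)
  smul_eq t ht w hw := by
    have h : t ^ d * sqLength (t • w) ^ (-(d : ℝ) / 2) = sqLength w ^ (-(d : ℝ) / 2) := by
      rw [sqLength_smul, Real.mul_rpow (by positivity) (sqLength_pos hw).le, ← mul_assoc,
        ← Real.rpow_natCast, ← Real.rpow_natCast t 2, ← Real.rpow_mul ht.le, ← Real.rpow_add ht]
      have : (d : ℝ) + ((2 : ℕ) : ℝ) * (-(d : ℝ) / 2) = 0 := by push_cast; ring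
      rw [this, Real.rpow_zero, one_mul]
    rw [powKernel, powKernel, ← h]
    simp [RCLike.real_smul_eq_coe_mul]

lemma isHomogeneousKernel_gradKernel (d : ℕ) :
    IsHomogeneousKernel (gradKernel 𝕜 d : E × ℝ → E →L[ℝ] 𝕜) (d + 1) where
  smooth := (contDiffOn_sqLength_rpow _).smul
    (contDiff_const.clm_comp ((innerSL ℝ).contDiff.comp contDiff_fst)).contDiffOn
  smul_eq t ht w hw := by
    have h : t ^ (d + 1) * sqLength (t • w) ^ (-((d : ℝ) + 2) / 2) * t =
        sqLength w ^ (-((d : ℝ) + 2) / 2) := by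
      rw [sqLength_smul, Real.mul_rpow (by positivity) (sqLength_pos hw).le,
        mul_right_comm, ← pow_succ, ← mul_assoc,
        ← Real.rpow_natCast, ← Real.rpow_natCast t 2, ← Real.rpow_mul ht.le, ← Real.rpow_add ht]
      have : ((d + 1 + 1 : ℕ) : ℝ) + ((2 : ℕ) : ℝ) * (-((d : ℝ) + 2) / 2) = 0 := by push_cast; ring
      rw [this, Real.rpow_zero, one_mul]
    rw [gradKernel, gradKernel, ← h]
    ext v
    simp only [Prod.smul_fst, map_smul, ContinuousLinearMap.comp_smul, smul_smul, mul_assoc]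

lemma contDiffOn_logKernel : ContDiffOn ℝ ∞ (logKernel 𝕜 : E × ℝ → 𝕜) {0}ᶜ :=
  (RCLike.ofRealCLM : ℝ →L[ℝ] 𝕜).contDiff.comp_contDiffOn
    ((contDiff_sqLength.contDiffOn.log fun _ hw => (sqLength_pos hw).ne').div_const 2)

/-- The logarithm is not homogeneous, so its bound is proved directly from `log t ≤ t - 1`. The
crude order `1` suffices because it is applied only in dimension at least two. -/
lemma kernelBound_logKernel : KernelBound (logKernel 𝕜 : E × ℝ → 𝕜) 1 := by
  refine ⟨5, fun z ε hz hz2 h0 h1 => ?_⟩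
  have hpos : 0 < ‖z‖ := norm_pos_iff.2 hz
  have hq : 0 < sqLength (z, ε) := sqLength_pos (by simp [hz])
  have hq1 : ‖z‖ ^ 2 ≤ sqLength (z, ε) := by simp [sqLength]; positivity
  have hq2 : sqLength (z, ε) ≤ 5 := by
    simp only [sqLength]
    nlinarith
  rw [logKernel, RCLike.norm_ofReal, Real.rpow_neg_one, abs_le]
  have hinv : 1 / 2 ≤ ‖z‖⁻¹ := by
    rw [one_div]
    exact inv_anti₀ hpos hz2
  constructor
  · have e1 := Real.log_le_log (by positivity) hq1
    rw [Real.log_pow] at e1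
    have e2 := Real.log_le_sub_one_of_pos (inv_pos.2 hpos)
    rw [Real.log_inv] at e2
    push_cast at e1
    linarith
  · have := Real.log_le_sub_one_of_pos hq
    linarith

lemma sliceDeriv_powKernel (d : ℕ) {w : E × ℝ} (hw : w ≠ 0) :
    sliceDeriv (powKernel 𝕜 d) w = (-(d : ℝ)) • gradKernel 𝕜 d w := by
  obtain ⟨z, ε⟩ := w
  have h1 := hasFDerivAt_slice (isHomogeneousKernel_powKernel (𝕜 := 𝕜) (E := E) d).smooth
    (z := z) (ε := ε) hw
  have h2 := (RCLike.ofRealCLM : ℝ →L[ℝ] 𝕜).hasFDerivAt.comp z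
    ((hasFDerivAt_sqLength z ε).rpow_const (p := -(d : ℝ) / 2) (Or.inl (sqLength_pos hw).ne'))
  refine (h1.unique h2).trans ?_
  ext v
  have : -(d : ℝ) / 2 - 1 = -((d : ℝ) + 2) / 2 := by ring
  simp only [this, gradKernel]
  generalize sqLength (z, ε) ^ (-((d : ℝ) + 2) / 2) = a
  simp [RCLike.real_smul_eq_coe_mul, map_ofNat (algebraMap ℝ 𝕜) 2]
  ring

/-- The logarithm plays the role of the power of degree `0`: its gradient is the `d = 0` gradient
kernel, without the factor `-d` that would annihilate it. -/
lemma sliceDeriv_logKernel {w : E × ℝ} (hw : w ≠ 0) :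
    sliceDeriv (logKernel 𝕜) w = gradKernel 𝕜 0 w := by
  obtain ⟨z, ε⟩ := w
  have h1 := hasFDerivAt_slice (contDiffOn_logKernel (𝕜 := 𝕜) (E := E))
    (z := z) (ε := ε) hw
  have h2 := (RCLike.ofRealCLM : ℝ →L[ℝ] 𝕜).hasFDerivAt.comp z
    (((hasFDerivAt_sqLength z ε).log (sqLength_pos hw).ne').mul_const (2 : ℝ)⁻¹)
  refine (h1.unique h2).trans ?_
  ext v
  simp [gradKernel, Real.rpow_neg_one, RCLike.real_smul_eq_coe_mul, map_ofNat (algebraMap ℝ 𝕜) 2]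
  ring

/-- Only the diagonal of the second derivative is computed, which is all a Laplacian requires. -/
lemma sliceDeriv_gradKernel_apply (d : ℕ) {w : E × ℝ} (hw : w ≠ 0) (v : E) :
    sliceDeriv (gradKernel 𝕜 d) w v v = ((sqLength w ^ (-((d : ℝ) + 2) / 2) * ‖v‖ ^ 2
      - ((d : ℝ) + 2) * sqLength w ^ (-((d : ℝ) + 4) / 2) * ⟪w.1, v⟫ ^ 2 : ℝ) : 𝕜) := by
  obtain ⟨z, ε⟩ := w
  have h1 := hasFDerivAt_slice (isHomogeneousKernel_gradKernel (𝕜 := 𝕜) (E := E) d).smooth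
    (z := z) (ε := ε) hw
  have h1' := h1.clm_apply (hasFDerivAt_const v z)
  have h2 : HasFDerivAt (fun z : E => ⟪z, v⟫) (innerSL ℝ v) z := by
    have := (innerSL ℝ v).hasFDerivAt (x := z)
    simpa [real_inner_comm] using this
  have h3 := (RCLike.ofRealCLM : ℝ →L[ℝ] 𝕜).hasFDerivAt.comp z
    (((hasFDerivAt_sqLength z ε).rpow_const (p := -((d : ℝ) + 2) / 2)
      (Or.inl (sqLength_pos hw).ne')).mul h2)
  have h4 : (fun z : E => gradKernel 𝕜 d (z, ε) v) =
      (RCLike.ofRealCLM : ℝ →L[ℝ] 𝕜) ∘ fun z => sqLength (z, ε) ^ (-((d : ℝ) + 2) / 2) * ⟪z, v⟫ := by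
    ext z
    simp [gradKernel, RCLike.real_smul_eq_coe_mul]
  rw [h4] at h1'
  have h5 := congrArg (fun L : E →L[ℝ] 𝕜 => L v) (h1'.unique h3)
  have : -((d : ℝ) + 2) / 2 - 1 = -((d : ℝ) + 4) / 2 := by ring
  simp only [this] at h5
  generalize sqLength (z, ε) ^ (-((d : ℝ) + 2) / 2) = p at h5 ⊢
  generalize sqLength (z, ε) ^ (-((d : ℝ) + 4) / 2) = q at h5 ⊢
  simp [RCLike.real_smul_eq_coe_mul, map_ofNat (algebraMap ℝ 𝕜) 2] at h5
  rw [h5]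
  push_cast
  ring

/-- The Laplacian of the radial kernels, with the regularization term. -/
lemma sum_sliceDeriv_gradKernel {ι : Type*} [Fintype ι] (b : OrthonormalBasis ι ℝ E) (d : ℕ)
    {w : E × ℝ} (hw : w ≠ 0) :
    ∑ i, sliceDeriv (gradKernel 𝕜 d) w (b i) (b i) =
      ((((Module.finrank ℝ E : ℝ) - d - 2) * sqLength w ^ (-((d : ℝ) + 2) / 2)
      + ((d : ℝ) + 2) * w.2 ^ 2 * sqLength w ^ (-((d : ℝ) + 4) / 2) : ℝ) : 𝕜) := by
  simp_rw [sliceDeriv_gradKernel_apply d hw]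
  rw [← RCLike.ofReal_sum]
  congr 1
  rw [Finset.sum_sub_distrib, ← Finset.mul_sum, ← Finset.mul_sum]
  have h1 : ∑ i, ‖b i‖ ^ 2 = Module.finrank ℝ E := by
    simp [Module.finrank_eq_card_basis b.toBasis]
  have h2 : ∑ i, ⟪w.1, b i⟫ ^ 2 = ‖w.1‖ ^ 2 := by
    rw [← b.sum_sq_norm_inner_left w.1]
    simp
  -- Writing `‖z‖²` as `sqLength w - ε²` isolates an `ε²` term. It vanishes at `ε = 0`, and at the
  -- critical order it carries the whole mass.
  have h3 : sqLength w ^ (-((d : ℝ) + 2) / 2) = sqLength w ^ (-((d : ℝ) + 4) / 2) * sqLength w := by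
    rw [← Real.rpow_add_one (sqLength_pos hw).ne']
    congr 1
    ring
  rw [h1, h2, h3]
  simp only [sqLength]
  ring

end RadialKernels

/-! ### Laplacians of radial potentials, below and at the critical order -/

section LaplacePotential

open scoped ContDiff

variable {E : Type*} [NormedAddCommGroup E] [InnerProductSpace ℝ E] [FiniteDimensional ℝ E]
  [MeasurableSpace E] [BorelSpace E] {𝕜 : Type*} [RCLike 𝕜]

lemma laplacian_eq_of_hasFDerivAt {U : E → 𝕜} {g : E → E →L[ℝ] 𝕜} {s : Set E} (hs : IsOpen s)
    (hU : ∀ x ∈ s, HasFDerivAt U (g x) x) {x : E} (hx : x ∈ s) :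
    Laplacian.laplacian U x = ∑ i, fderiv ℝ g x (stdOrthonormalBasis ℝ E i)
      (stdOrthonormalBasis ℝ E i) := by
  have h : fderiv ℝ U =ᶠ[𝓝 x] g := by
    filter_upwards [hs.mem_nhds hx] with y hy
    exact (hU y hy).fderiv
  rw [InnerProductSpace.laplacian_eq_iteratedFDeriv_stdOrthonormalBasis]
  simp [iteratedFDeriv_two_apply, h.fderiv_eq]

/-- The identities between kernels hold only off the origin; at `ε = 0` the exceptional point is
null. -/
lemma potential_congr [Nontrivial E] {V : Type*} [NormedAddCommGroup V] [NormedSpace 𝕜 V]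
    [NormedSpace ℝ V] [IsScalarTower ℝ 𝕜 V] (f : E → 𝕜) {F G : E × ℝ → V}
    (h : ∀ w, w ≠ 0 → F w = G w) (ε : ℝ) (x : E) : potential f F ε x = potential f G ε x := by
  rw [potential_eq, potential_eq]
  refine integral_congr_ae ?_
  filter_upwards [ae_ne_zero (E := E)] with z hz
  rw [h _ (by simp [hz])]

lemma potential_const_smul {V : Type*} [NormedAddCommGroup V] [NormedSpace 𝕜 V]
    [NormedSpace ℝ V] [IsScalarTower ℝ 𝕜 V] (f : E → 𝕜) (F : E × ℝ → V) (c : ℝ) (ε : ℝ) (x : E) :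
    potential f (fun w => c • F w) ε x = c • potential f F ε x := by
  rw [potential, potential, ← integral_smul]
  simp_rw [smul_comm _ c]

lemma potential_apply {V : Type*} [NormedAddCommGroup V] [NormedSpace 𝕜 V]
    [NormedSpace ℝ V] [IsScalarTower ℝ 𝕜 V] {f : E → 𝕜} {F : E × ℝ → E →L[ℝ] V} {ε : ℝ} {x : E}
    (h : Integrable fun y => f y • F (x - y, ε)) (v : E) :
    potential f F ε x v = potential f (fun w => F w v) ε x := by
  rw [potential, ContinuousLinearMap.integral_apply h]
  rfl

variable (E 𝕜) in
/-- The Laplacian of the radial kernel whose gradient is `gradKernel 𝕜 d`. -/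
noncomputable def traceKernel (d : ℕ) (w : E × ℝ) : 𝕜 :=
  ((((Module.finrank ℝ E : ℝ) - d - 2) * sqLength w ^ (-((d : ℝ) + 2) / 2)
    + ((d : ℝ) + 2) * w.2 ^ 2 * sqLength w ^ (-((d : ℝ) + 4) / 2) : ℝ) : 𝕜)

/-- The trace of the potential of the second derivatives of a radial kernel. -/
lemma sum_potential_sliceDeriv_gradKernel [Nontrivial E] {f : E → 𝕜} {d : ℕ} {ε : ℝ} {x : E}
    (h : Integrable fun y => f y • sliceDeriv (gradKernel 𝕜 d) (x - y, ε)) :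
    ∑ i, potential f (sliceDeriv (gradKernel 𝕜 d)) ε x (stdOrthonormalBasis ℝ E i)
      (stdOrthonormalBasis ℝ E i) = potential f (traceKernel E 𝕜 d) ε x := by
  have h1 : ∀ v, Integrable fun y => f y • sliceDeriv (gradKernel 𝕜 d) (x - y, ε) v := fun v =>
    (ContinuousLinearMap.apply ℝ (E →L[ℝ] 𝕜) v).integrable_comp h
  have h2 : ∀ v, Integrable fun y => f y • sliceDeriv (gradKernel 𝕜 d) (x - y, ε) v v := fun v =>
    (ContinuousLinearMap.apply ℝ 𝕜 v).integrable_comp (h1 v)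
  have h3 : potential f (traceKernel E 𝕜 d) ε x = potential f (fun w : E × ℝ =>
      ∑ i, sliceDeriv (gradKernel 𝕜 d) w (stdOrthonormalBasis ℝ E i)
        (stdOrthonormalBasis ℝ E i)) ε x :=
    potential_congr f
      (fun w hw => (sum_sliceDeriv_gradKernel (stdOrthonormalBasis ℝ E) d hw).symm) ε x
  have h4 : ∀ v, potential f (sliceDeriv (gradKernel 𝕜 d)) ε x v v =
      ∫ y, f y • sliceDeriv (gradKernel 𝕜 d) (x - y, ε) v v := by
    intro v
    rw [potential_apply h, potential_apply (F := fun w => sliceDeriv (gradKernel 𝕜 d) w v) (h1 v),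
      potential]
  rw [h3, Finset.sum_congr rfl fun i _ => h4 _, ← integral_finsetSum _ fun i _ => h2 _, potential]
  simp_rw [Finset.smul_sum]

lemma hasFDerivAt_potential_powKernel [Nontrivial E] {f : E → 𝕜} {M : ℝ}
    (hf : IsBallDensity f M) {d : ℕ} (hd : d + 1 < Module.finrank ℝ E)
    {x : E} (hx : x ∈ Metric.ball (0 : E) 1) :
    HasFDerivAt (potential f (powKernel 𝕜 d) 0)
      ((-(d : ℝ)) • potential f (gradKernel 𝕜 d) 0 x) x := by
  have h := isHomogeneousKernel_powKernel (𝕜 := 𝕜) (E := E) d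
  have := hasFDerivAt_potential hf h.smooth h.kernelBound (by exact_mod_cast (by omega))
    h.sliceDeriv.kernelBound (by exact_mod_cast hd) hx
  rwa [potential_congr f (fun w hw => sliceDeriv_powKernel d hw), potential_const_smul] at this

lemma hasFDerivAt_potential_logKernel [Nontrivial E] {f : E → 𝕜} {M : ℝ}
    (hf : IsBallDensity f M) (hE : 1 < Module.finrank ℝ E)
    {x : E} (hx : x ∈ Metric.ball (0 : E) 1) :
    HasFDerivAt (potential f (logKernel 𝕜) 0) (potential f (gradKernel 𝕜 0) 0 x) x := by
  have hb : KernelBound (sliceDeriv (logKernel 𝕜 : E × ℝ → 𝕜)) 1 := by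
    obtain ⟨C, hC⟩ := (isHomogeneousKernel_gradKernel (𝕜 := 𝕜) (E := E) 0).kernelBound
    refine ⟨C, fun z ε hz h1 h2 h3 => ?_⟩
    rw [sliceDeriv_logKernel (by simp [hz])]
    simpa using hC z ε hz h1 h2 h3
  have := hasFDerivAt_potential hf contDiffOn_logKernel kernelBound_logKernel
    (by exact_mod_cast hE) hb (by exact_mod_cast hE) hx
  rwa [potential_congr f (fun w hw => sliceDeriv_logKernel hw)] at this

/-- Trace of the derivative of the gradient potential below the critical order. -/
lemma sum_fderiv_potential_gradKernel [Nontrivial E] {f : E → 𝕜} {M : ℝ}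
    (hf : IsBallDensity f M) {d : ℕ} (hd : d + 2 < Module.finrank ℝ E)
    {x : E} (hx : x ∈ Metric.ball (0 : E) 1) :
    ∑ i, fderiv ℝ (potential f (gradKernel 𝕜 d) 0) x (stdOrthonormalBasis ℝ E i)
      (stdOrthonormalBasis ℝ E i) =
      ((Module.finrank ℝ E : ℝ) - d - 2) • potential f (powKernel 𝕜 (d + 2)) 0 x := by
  have h := isHomogeneousKernel_gradKernel (𝕜 := 𝕜) (E := E) d
  have hd' : ((d + 1 + 1 : ℕ) : ℝ) < Module.finrank ℝ E := by exact_mod_cast hd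
  rw [(hasFDerivAt_potential hf h.smooth h.kernelBound (by exact_mod_cast (by omega))
    h.sliceDeriv.kernelBound hd' hx).fderiv,
    sum_potential_sliceDeriv_gradKernel
      (integrable_potential hf h.sliceDeriv.smooth.continuousOn h.sliceDeriv.kernelBound hd' le_rfl
        zero_le_one hx), ← potential_const_smul]
  rw [potential, potential]
  refine integral_congr_ae (Eventually.of_forall fun y => ?_)
  simp [traceKernel, powKernel, RCLike.real_smul_eq_coe_mul, map_ofNat (algebraMap ℝ 𝕜) 2]

/-- `-Δ` lowers the degree of the radial potentials by two. -/
lemma laplacian_potential_powKernel [Nontrivial E] {f : E → 𝕜} {M : ℝ}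
    (hf : IsBallDensity f M) {d : ℕ} (hd : d + 2 < Module.finrank ℝ E)
    {x : E} (hx : x ∈ Metric.ball (0 : E) 1) :
    -Laplacian.laplacian (potential f (powKernel 𝕜 d) 0) x =
      ((d : ℝ) * ((Module.finrank ℝ E : ℝ) - 2 - d)) • potential f (powKernel 𝕜 (d + 2)) 0 x := by
  rw [laplacian_eq_of_hasFDerivAt Metric.isOpen_ball
    (fun x hx => hasFDerivAt_potential_powKernel hf (by omega) hx) hx]
  have h1 : fderiv ℝ (fun x => (-(d : ℝ)) • potential f (gradKernel 𝕜 d) 0 x) x =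
      (-(d : ℝ)) • fderiv ℝ (potential f (gradKernel 𝕜 d) 0) x :=
    congrFun (fderiv_const_smul_field (𝕜 := ℝ) (f := potential f (gradKernel 𝕜 d) 0) (-(d : ℝ))) x
  rw [h1]
  simp only [smul_apply]
  rw [← Finset.smul_sum, sum_fderiv_potential_gradKernel hf hd hx, smul_smul, ← neg_smul]
  congr 1
  ring

lemma laplacian_potential_logKernel [Nontrivial E] {f : E → 𝕜} {M : ℝ}
    (hf : IsBallDensity f M) (hE : 2 < Module.finrank ℝ E)
    {x : E} (hx : x ∈ Metric.ball (0 : E) 1) :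
    Laplacian.laplacian (potential f (logKernel 𝕜) 0) x =
      ((Module.finrank ℝ E : ℝ) - 2) • potential f (powKernel 𝕜 2) 0 x := by
  rw [laplacian_eq_of_hasFDerivAt Metric.isOpen_ball
    (fun x hx => hasFDerivAt_potential_logKernel hf (by omega) hx) hx]
  simpa using sum_fderiv_potential_gradKernel hf (d := 0) hE hx

/-- The total mass of the limit of the regularized Laplacians. -/
lemma integral_radial_bump [Nontrivial E] :
    ∫ z : E, (Module.finrank ℝ E : ℝ) * (1 + ‖z‖ ^ 2) ^ (-((Module.finrank ℝ E : ℝ) + 2) / 2) =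
      Module.finrank ℝ E * (volume : Measure E).real (Metric.ball 0 1) := by
  have hn : 1 ≤ Module.finrank ℝ E := Module.finrank_pos
  set n := Module.finrank ℝ E with hndef
  rw [integral_fun_norm_addHaar volume
    (fun r : ℝ => (n : ℝ) * (1 + r ^ 2) ^ (-((n : ℝ) + 2) / 2))]
  have hpos : ∀ r : ℝ, 0 < 1 + r ^ 2 := fun r => by positivity
  have key : ∫ r in Set.Ioi (0 : ℝ), r ^ (n - 1) • ((n : ℝ) * (1 + r ^ 2) ^ (-((n : ℝ) + 2) / 2)) =
      1 - (0 : ℝ) ^ n * (1 + (0 : ℝ) ^ 2) ^ (-(n : ℝ) / 2) := by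
    -- The integrand has the explicit primitive `r ^ n * (1 + r ^ 2) ^ (-n / 2)`, which rises from
    -- `0` at the origin to `1` at infinity.
    refine integral_Ioi_of_hasDerivAt_of_nonneg' (g := fun r : ℝ => r ^ n * (1 + r ^ 2) ^ (-(n : ℝ) / 2))
      (fun r _ => ?_) (fun r hr => ?_) ?_
    · have h1 : HasDerivAt (fun r : ℝ => 1 + r ^ 2) (2 * r) r := by
        simpa using (hasDerivAt_pow 2 r).const_add 1
      have h2 := (hasDerivAt_pow n r).mul (h1.rpow_const (p := -(n : ℝ) / 2) (Or.inl (hpos r).ne'))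
      refine h2.congr_deriv ?_
      have e1 : (1 + r ^ 2) ^ (-(n : ℝ) / 2) = (1 + r ^ 2) ^ (-((n : ℝ) + 2) / 2) * (1 + r ^ 2) := by
        rw [← Real.rpow_add_one (hpos r).ne']
        congr 1
        ring
      have e2 : -(n : ℝ) / 2 - 1 = -((n : ℝ) + 2) / 2 := by ring
      have e3 : r ^ n = r ^ (n - 1) * r := by
        rw [← pow_succ, Nat.sub_add_cancel hn]
      rw [e1, e2, e3, smul_eq_mul]
      ring
    · have hr' : (0 : ℝ) < r := hr
      have := hpos r
      positivity
    · have h1 : Tendsto (fun r : ℝ => (1 - 1 / (1 + r ^ 2)) ^ ((n : ℝ) / 2)) atTop (𝓝 1) := by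
        have h2 : Tendsto (fun r : ℝ => 1 - 1 / (1 + r ^ 2)) atTop (𝓝 1) := by
          have h3 : Tendsto (fun r : ℝ => 1 + r ^ 2) atTop atTop :=
            tendsto_atTop_add_const_left _ _ (tendsto_pow_atTop two_ne_zero)
          simpa using (tendsto_const_nhds (x := (1 : ℝ))).sub (h3.inv_tendsto_atTop)
        simpa using h2.rpow_const (p := (n : ℝ) / 2) (Or.inl one_ne_zero)
      refine h1.congr' ?_
      filter_upwards [eventually_gt_atTop 0] with r hr
      have e1 : 1 - 1 / (1 + r ^ 2) = r ^ 2 / (1 + r ^ 2) := by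
        have := (hpos r).ne'
        field_simp
        ring
      rw [e1, Real.div_rpow (by positivity) (hpos r).le, ← Real.rpow_natCast r 2,
        ← Real.rpow_mul hr.le, div_eq_mul_inv, ← Real.rpow_neg (by positivity), ← Real.rpow_natCast]
      congr 2
      · push_cast
        ring
      · ring
  rw [key, zero_pow (by omega), ← hndef]
  simp

/-- At the critical order the regularized Laplacians form an approximate identity. -/
lemma tendsto_potential_traceKernel [Nontrivial E] {f : E → 𝕜} {M : ℝ}
    (hf : IsBallDensity f M) {d : ℕ} (hd : d + 2 = Module.finrank ℝ E) {x : E}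
    (hfx : ContinuousAt f x) :
    Tendsto (fun k => potential f (traceKernel E 𝕜 d) (regParam k) x) atTop
      (𝓝 ((Module.finrank ℝ E * (volume : Measure E).real (Metric.ball 0 1)) • f x)) := by
  have hmass := integral_radial_bump (E := E)
  set n := Module.finrank ℝ E with hn
  set σ : ℝ := n * (volume : Measure E).real (Metric.ball 0 1) with hσ
  have hn0 : 0 < n := Module.finrank_pos
  have hσ0 : 0 < σ := by
    have : 0 < (volume : Measure E).real (Metric.ball 0 1) :=
      ENNReal.toReal_pos (Metric.measure_ball_pos volume (0 : E) one_pos).ne'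
        measure_ball_lt_top.ne
    positivity
  have hpos : ∀ z : E, 0 < 1 + ‖z‖ ^ 2 := fun z => by positivity
  set ψ : E → ℝ := fun z => σ⁻¹ * (n * (1 + ‖z‖ ^ 2) ^ (-((n : ℝ) + 2) / 2)) with hψ
  have h0 : ∀ z, 0 ≤ ψ z := fun z => by
    have := hpos z
    positivity
  have h1 : ∫ z, ψ z = 1 := by
    rw [hψ, integral_const_mul, hmass, inv_mul_cancel₀ hσ0.ne']
  -- `ψ` is not compactly supported, so the approximate identity theorem asks for decay faster than
  -- `‖z‖ ^ (-n)`.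
  have h2 : Tendsto (fun z => ‖z‖ ^ n * ψ z) (Bornology.cobounded E) (𝓝 0) := by
    have h3 : Tendsto (fun z : E => σ⁻¹ * n * (‖z‖ ^ 2)⁻¹) (Bornology.cobounded E) (𝓝 0) := by
      have h4 : Tendsto (fun z : E => (‖z‖ ^ 2)) (Bornology.cobounded E) atTop :=
        (tendsto_pow_atTop two_ne_zero).comp tendsto_norm_cobounded_atTop
      simpa using h4.inv_tendsto_atTop.const_mul (σ⁻¹ * n)
    refine squeeze_zero' (Eventually.of_forall fun z => mul_nonneg (by positivity) (h0 z)) ?_ h3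
    filter_upwards [tendsto_norm_cobounded_atTop.eventually_gt_atTop 0] with z hz
    have e1 : (1 + ‖z‖ ^ 2) ^ (-((n : ℝ) + 2) / 2) ≤ (‖z‖ ^ 2) ^ (-((n : ℝ) + 2) / 2) :=
      Real.rpow_le_rpow_of_nonpos (by positivity) (by linarith)
        (by have : (0 : ℝ) ≤ n := Nat.cast_nonneg n
            linarith)
    have e2 : ‖z‖ ^ n * (‖z‖ ^ 2) ^ (-((n : ℝ) + 2) / 2) = (‖z‖ ^ 2)⁻¹ := by
      rw [← Real.rpow_natCast, ← Real.rpow_natCast _ 2, ← Real.rpow_mul hz.le, ← Real.rpow_add hz,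
        ← Real.rpow_neg hz.le]
      congr 1
      push_cast
      ring
    calc ‖z‖ ^ n * ψ z = σ⁻¹ * n * (‖z‖ ^ n * (1 + ‖z‖ ^ 2) ^ (-((n : ℝ) + 2) / 2)) := by
          simp only [hψ]; ring
      _ ≤ σ⁻¹ * n * (‖z‖ ^ n * (‖z‖ ^ 2) ^ (-((n : ℝ) + 2) / 2)) := by gcongr
      _ = _ := by rw [e2]
  have h5 := tendsto_integral_comp_smul_smul_of_integrable' (μ := (volume : Measure E)) h0 h1 h2
    hf.integrable hfx
  have hk : Tendsto (fun k : ℕ => (k : ℝ) + 1) atTop atTop :=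
    tendsto_atTop_add_const_right _ _ tendsto_natCast_atTop_atTop
  refine ((h5.comp hk).const_smul σ).congr fun k => ?_
  simp only [Function.comp_apply]
  rw [← integral_smul, potential]
  refine integral_congr_ae (Eventually.of_forall fun y => ?_)
  simp only
  set c : ℝ := (k : ℝ) + 1 with hc
  have hc0 : 0 < c := by positivity
  have hε : regParam k = c⁻¹ := by rw [regParam, one_div]
  have hd' : (d : ℝ) + 2 = n := by exact_mod_cast hd
  -- Since `d + 2 = n`, the first summand of `traceKernel` drops out. With `c = 1 / ε` the remaining
  -- one is `σ` times the rescaled profile `c ^ n * ψ (c • z)`.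
  have e1 : traceKernel E 𝕜 d (x - y, regParam k) = ((σ * (c ^ n * ψ (c • (x - y))) : ℝ) : 𝕜) := by
    rw [traceKernel]
    congr 1
    have e2 : (1 + ‖c • (x - y)‖ ^ 2) = c ^ 2 * sqLength (x - y, regParam k) := by
      rw [sqLength, norm_smul, hε, Real.norm_of_nonneg hc0.le]
      field_simp
      ring
    have hq : 0 < sqLength (x - y, regParam k) :=
      sqLength_pos (by simp [(regParam_pos k).ne'])
    have e3 : (c ^ 2) ^ (-((n : ℝ) + 2) / 2) = (c ^ n * c ^ 2)⁻¹ := by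
      rw [← pow_add, ← Real.rpow_natCast, ← Real.rpow_natCast, ← Real.rpow_mul hc0.le,
        ← Real.rpow_neg hc0.le]
      congr 1
      push_cast
      ring
    have e4 : -((d : ℝ) + 4) / 2 = -((n : ℝ) + 2) / 2 := by rw [← hd']; ring
    simp only [hψ]
    rw [e2, Real.mul_rpow (by positivity) hq.le, e3, e4, hd', hε, ← hn,
      show (n : ℝ) - d - 2 = 0 by linarith]
    have := hσ0.ne'
    field_simp
    ring
  rw [e1, smul_smul, smul_eq_mul, RCLike.real_smul_eq_coe_mul, mul_comm]

/-- One sequence, two limits: the regularized second derivatives converge to the derivative of the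
gradient potential by the Hölder estimate, while their traces form an approximate identity. -/
lemma sum_fderiv_potential_gradKernel_critical [Nontrivial E] {f : E → 𝕜} {M : ℝ}
    (hf : IsBallDensity f M) {A lam : ℝ} (hlam : 0 < lam)
    (hfA : ∀ x ∈ Metric.ball (0 : E) 1, ∀ y ∈ Metric.ball (0 : E) 1,
      ‖f x - f y‖ ≤ A * ‖x - y‖ ^ lam)
    {d : ℕ} (hd : d + 2 = Module.finrank ℝ E) {x : E} (hx : x ∈ Metric.ball (0 : E) 1)
    (hfx : ContinuousAt f x) :
    ∑ i, fderiv ℝ (potential f (gradKernel 𝕜 d) 0) x (stdOrthonormalBasis ℝ E i)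
      (stdOrthonormalBasis ℝ E i) =
      (Module.finrank ℝ E * (volume : Measure E).real (Metric.ball 0 1)) • f x := by
  have h := isHomogeneousKernel_gradKernel (𝕜 := 𝕜) (E := E) d
  have hb := h.sliceDeriv.kernelBound
  have h1 := (contDiffOn_one_potential hf hlam hfA h.smooth h.kernelBound
    (by exact_mod_cast (by omega)) (by rw [← hd]; exact hb)).2 x hx
  refine tendsto_nhds_unique ?_ (tendsto_potential_traceKernel hf hd hfx)
  have h2 : ∀ k, potential f (traceKernel E 𝕜 d) (regParam k) x =
      ∑ i, potential f (sliceDeriv (gradKernel 𝕜 d)) (regParam k) x (stdOrthonormalBasis ℝ E i)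
      (stdOrthonormalBasis ℝ E i) := by
    intro k
    refine (sum_potential_sliceDeriv_gradKernel ?_).symm
    exact integrable_density_smul hf
      ((continuous_slice_of_pos (contDiffOn_sliceDeriv h.smooth).continuousOn
        (regParam_pos k)).comp (by fun_prop : Continuous fun y => x - y))
  simp_rw [h2]
  refine tendsto_finsetSum _ fun i _ => ?_
  have h3 := ((ContinuousLinearMap.apply ℝ (E →L[ℝ] 𝕜)
    (stdOrthonormalBasis ℝ E i)).continuous.tendsto _).comp h1
  exact ((ContinuousLinearMap.apply ℝ 𝕜 (stdOrthonormalBasis ℝ E i)).continuous.tendsto _).comp h3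

end LaplacePotential

/-! ### Powers of the Laplacian applied to the potentials -/

section IteratedLaplacian

open scoped ContDiff

variable {n : ℕ} {𝕜 : Type*} [RCLike 𝕜]

lemma laplacian_const_smul_field {E : Type*} [NormedAddCommGroup E] [InnerProductSpace ℝ E]
    [FiniteDimensional ℝ E] (c : ℝ) (u : E → 𝕜) :
    Laplacian.laplacian (c • u) = c • Laplacian.laplacian u := by
  ext x
  rw [InnerProductSpace.laplacian_eq_iteratedFDeriv_stdOrthonormalBasis,
    InnerProductSpace.laplacian_eq_iteratedFDeriv_stdOrthonormalBasis]
  have h1 : fderiv ℝ (c • u) = c • fderiv ℝ u := fderiv_const_smul_field c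
  have h2 : fderiv ℝ (c • fderiv ℝ u) = c • fderiv ℝ (fderiv ℝ u) :=
    fderiv_const_smul_field (𝕜 := ℝ) (f := fderiv ℝ u) c
  simp [iteratedFDeriv_two_apply, h1, h2, Finset.smul_sum]

lemma laplacian_add_const {E : Type*} [NormedAddCommGroup E] [InnerProductSpace ℝ E]
    [FiniteDimensional ℝ E] (u : E → 𝕜) (c : 𝕜) :
    Laplacian.laplacian (fun x => u x + c) = Laplacian.laplacian u := by
  ext x
  rw [InnerProductSpace.laplacian_eq_iteratedFDeriv_stdOrthonormalBasis,
    InnerProductSpace.laplacian_eq_iteratedFDeriv_stdOrthonormalBasis]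
  have : fderiv ℝ (fun x => u x + c) = fderiv ℝ u := by
    ext1 y
    exact fderiv_add_const c
  simp [iteratedFDeriv_two_apply, this]

lemma negLaplacianPow_succ (k : ℕ) (u : EuclideanSpace ℝ (Fin n) → 𝕜) :
    negLaplacianPow (k + 1) u = negLaplacianPow k (-Laplacian.laplacian u) :=
  Function.iterate_succ_apply _ _ _

lemma negLaplacianPow_congr {s : Set (EuclideanSpace ℝ (Fin n))} (hs : IsOpen s) (k : ℕ) :
    ∀ {u v : EuclideanSpace ℝ (Fin n) → 𝕜}, Set.EqOn u v s →
      Set.EqOn (negLaplacianPow k u) (negLaplacianPow k v) s := by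
  induction k with
  | zero => intro u v h; exact h
  | succ k ih =>
    intro u v h
    rw [negLaplacianPow_succ, negLaplacianPow_succ]
    refine ih fun x hx => ?_
    have : u =ᶠ[𝓝 x] v := by
      filter_upwards [hs.mem_nhds hx] with y hy
      exact h hy
    simp only [Pi.neg_apply]
    rw [(InnerProductSpace.laplacian_congr_nhds this).self_of_nhds]

lemma negLaplacianPow_const_smul (c : ℝ) (k : ℕ) :
    ∀ u : EuclideanSpace ℝ (Fin n) → 𝕜, negLaplacianPow k (c • u) = c • negLaplacianPow k u := by
  induction k with
  | zero => intro u; rfl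
  | succ k ih =>
    intro u
    rw [negLaplacianPow_succ, negLaplacianPow_succ, laplacian_const_smul_field, ← smul_neg, ih]

variable {f : EuclideanSpace ℝ (Fin n) → 𝕜} {M : ℝ}

/-- The surface area of the unit sphere, as it appears in the fundamental solution. -/
noncomputable def sphereMass (n : ℕ) : ℝ :=
  n * (volume : Measure (EuclideanSpace ℝ (Fin n))).real (Metric.ball 0 1)

lemma nontrivial_euclideanSpace (hn : 1 ≤ n) : Nontrivial (EuclideanSpace ℝ (Fin n)) :=
  Module.nontrivial_of_finrank_pos (R := ℝ) (by rw [finrank_euclideanSpace_fin]; omega)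

lemma laplacian_potential_powKernel_critical (hf : IsBallDensity f M) {A lam : ℝ} (hlam : 0 < lam)
    (hfA : ∀ x ∈ Metric.ball (0 : EuclideanSpace ℝ (Fin n)) 1,
      ∀ y ∈ Metric.ball (0 : EuclideanSpace ℝ (Fin n)) 1, ‖f x - f y‖ ≤ A * ‖x - y‖ ^ lam)
    (hfc : ∀ x ∈ Metric.ball (0 : EuclideanSpace ℝ (Fin n)) 1, ContinuousAt f x)
    {d : ℕ} (hd : d + 2 = n) {x : EuclideanSpace ℝ (Fin n)} (hx : x ∈ Metric.ball 0 1) :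
    -Laplacian.laplacian (potential f (powKernel 𝕜 d) 0) x = ((d : ℝ) * sphereMass n) • f x := by
  have := nontrivial_euclideanSpace (n := n) (by omega)
  rw [laplacian_eq_of_hasFDerivAt Metric.isOpen_ball
    (fun x hx => hasFDerivAt_potential_powKernel hf (d := d) (by simp; omega) hx) hx]
  have h1 : fderiv ℝ (fun x => (-(d : ℝ)) • potential f (gradKernel 𝕜 d) 0 x) x =
      (-(d : ℝ)) • fderiv ℝ (potential f (gradKernel 𝕜 d) 0) x :=
    congrFun (fderiv_const_smul_field (𝕜 := ℝ) (f := potential f (gradKernel 𝕜 d) 0) (-(d : ℝ))) x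
  rw [h1]
  simp only [smul_apply]
  rw [← Finset.smul_sum, sum_fderiv_potential_gradKernel_critical hf hlam hfA (by simpa using hd) hx
    (hfc x hx), smul_smul, ← neg_smul, sphereMass]
  simp

/-- Each subcritical Laplacian raises `d` by two at the cost of `d * (n - 2 - d)`. The second
factors run through the even numbers `2 * m, …, 2` and give `2 ^ m * m!`; the critical last step
contributes `sphereMass n` in place of a zero factor. -/
lemma negLaplacianPow_potential_powKernel (hf : IsBallDensity f M) {A lam : ℝ} (hlam : 0 < lam)
    (hfA : ∀ x ∈ Metric.ball (0 : EuclideanSpace ℝ (Fin n)) 1,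
      ∀ y ∈ Metric.ball (0 : EuclideanSpace ℝ (Fin n)) 1, ‖f x - f y‖ ≤ A * ‖x - y‖ ^ lam)
    (hfc : ∀ x ∈ Metric.ball (0 : EuclideanSpace ℝ (Fin n)) 1, ContinuousAt f x) (m : ℕ) :
    ∀ d : ℕ, d + 2 * m + 2 = n → ∀ x ∈ Metric.ball (0 : EuclideanSpace ℝ (Fin n)) 1,
      negLaplacianPow (m + 1) (potential f (powKernel 𝕜 d) 0) x =
        (sphereMass n * 2 ^ m * m.factorial * ∏ j ∈ Finset.range (m + 1), ((d : ℝ) + 2 * j)) •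
          f x := by
  induction m with
  | zero =>
    intro d hd x hx
    have := laplacian_potential_powKernel_critical hf hlam hfA hfc (d := d) (by omega) hx
    rw [negLaplacianPow_succ]
    change -Laplacian.laplacian (potential f (powKernel 𝕜 d) 0) x = _
    rw [this]
    simp [mul_comm]
  | succ m ih =>
    intro d hd x hx
    have := nontrivial_euclideanSpace (n := n) (by omega)
    have h1 : Set.EqOn (-Laplacian.laplacian (potential f (powKernel 𝕜 d) 0))
        (((d : ℝ) * (2 * (m + 1))) • potential f (powKernel 𝕜 (d + 2)) 0)
        (Metric.ball (0 : EuclideanSpace ℝ (Fin n)) 1) := by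
      intro y hy
      simp only [Pi.neg_apply, Pi.smul_apply]
      rw [laplacian_potential_powKernel hf (by simp; omega) hy, finrank_euclideanSpace_fin]
      congr 2
      rw [← hd]
      push_cast
      ring
    rw [negLaplacianPow_succ, negLaplacianPow_congr Metric.isOpen_ball (m + 1) h1 hx,
      negLaplacianPow_const_smul, Pi.smul_apply, ih (d + 2) (by omega) x hx, smul_smul]
    congr 1
    rw [Finset.prod_range_succ' _ (m + 1), Nat.factorial_succ]
    have : ∀ j : ℕ, (d : ℝ) + 2 * ((j + 1 : ℕ) : ℝ) = ((d + 2 : ℕ) : ℝ) + 2 * j := by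
      intro j
      push_cast
      ring
    simp_rw [this]
    push_cast
    ring

/-- In dimension two the first Laplacian is already critical. Otherwise it leads to the power
potential with `d = 2`, to which the previous lemma applies. -/
lemma negLaplacianPow_potential_logKernel (hf : IsBallDensity f M) {A lam : ℝ} (hlam : 0 < lam)
    (hfA : ∀ x ∈ Metric.ball (0 : EuclideanSpace ℝ (Fin n)) 1,
      ∀ y ∈ Metric.ball (0 : EuclideanSpace ℝ (Fin n)) 1, ‖f x - f y‖ ≤ A * ‖x - y‖ ^ lam)
    (hfc : ∀ x ∈ Metric.ball (0 : EuclideanSpace ℝ (Fin n)) 1, ContinuousAt f x) {m : ℕ}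
    (hm : 2 * m + 2 = n) {x : EuclideanSpace ℝ (Fin n)} (hx : x ∈ Metric.ball 0 1) :
    negLaplacianPow (m + 1) (potential f (logKernel 𝕜) 0) x =
        (-(sphereMass n * 4 ^ m * (m.factorial : ℝ) ^ 2)) • f x := by
  have := nontrivial_euclideanSpace (n := n) (by omega)
  rw [negLaplacianPow_succ]
  rcases m with _ | m
  · change -Laplacian.laplacian (potential f (logKernel 𝕜) 0) x = _
    rw [laplacian_eq_of_hasFDerivAt Metric.isOpen_ball
      (fun x hx => hasFDerivAt_potential_logKernel hf (by simp; omega) hx) hx,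
      sum_fderiv_potential_gradKernel_critical hf hlam hfA (by simpa using hm) hx (hfc x hx)]
    simp [sphereMass]
  · have h1 : Set.EqOn (-Laplacian.laplacian (potential f (logKernel 𝕜) 0))
        ((-(2 * ((m : ℝ) + 1))) • potential f (powKernel 𝕜 2) 0)
        (Metric.ball (0 : EuclideanSpace ℝ (Fin n)) 1) := by
      intro y hy
      simp only [Pi.neg_apply, Pi.smul_apply]
      rw [laplacian_potential_logKernel hf (by simp; omega) hy, finrank_euclideanSpace_fin, neg_smul]
      congr 2
      rw [← hm]
      push_cast
      ring
    rw [negLaplacianPow_congr Metric.isOpen_ball (m + 1) h1 hx,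
      negLaplacianPow_const_smul, Pi.smul_apply,
      negLaplacianPow_potential_powKernel hf hlam hfA hfc m 2 (by omega) x hx, smul_smul]
    congr 1
    have h2 : ∏ j ∈ Finset.range (m + 1), (((2 : ℕ) : ℝ) + 2 * j) =
        2 ^ (m + 1) * ((m + 1).factorial : ℝ) := by
      rw [← Finset.prod_range_add_one_eq_factorial]
      push_cast
      have : ∀ j : ℕ, (2 : ℝ) + 2 * j = 2 * (j + 1) := fun j => by ring
      simp_rw [this]
      rw [Finset.prod_mul_distrib]
      simp
    rw [h2, Nat.factorial_succ, show (4 : ℝ) = 2 * 2 by norm_num, mul_pow]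
    push_cast
    ring

lemma contDiffOn_potential_powKernel_one (hn : 2 ≤ n) (hf : IsBallDensity f M) {A lam : ℝ}
    (hlam : 0 < lam)
    (hfA : ∀ x ∈ Metric.ball (0 : EuclideanSpace ℝ (Fin n)) 1,
      ∀ y ∈ Metric.ball (0 : EuclideanSpace ℝ (Fin n)) 1, ‖f x - f y‖ ≤ A * ‖x - y‖ ^ lam) :
    ContDiffOn ℝ ((n - 1 : ℕ) : WithTop ℕ∞) (potential f (powKernel 𝕜 1) 0) (Metric.ball 0 1) := by
  have := nontrivial_euclideanSpace (n := n) (by omega)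
  have h := contDiffOn_potential hf hlam hfA (n - 2)
    (isHomogeneousKernel_powKernel (𝕜 := 𝕜) (E := EuclideanSpace ℝ (Fin n)) 1) (by simp; omega)
  rwa [show n - 2 + 1 = n - 1 by omega] at h

/-- The gradient of the logarithm is homogeneous of degree `-1`: one derivative is taken by hand,
and the other `n - 1` come from `contDiffOn_potential`. -/
lemma contDiffOn_potential_logKernel (hn : 2 ≤ n) (hf : IsBallDensity f M) {A lam : ℝ}
    (hlam : 0 < lam)
    (hfA : ∀ x ∈ Metric.ball (0 : EuclideanSpace ℝ (Fin n)) 1,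
      ∀ y ∈ Metric.ball (0 : EuclideanSpace ℝ (Fin n)) 1, ‖f x - f y‖ ≤ A * ‖x - y‖ ^ lam) :
    ContDiffOn ℝ (n : WithTop ℕ∞) (potential f (logKernel 𝕜) 0) (Metric.ball 0 1) := by
  have := nontrivial_euclideanSpace (n := n) (by omega)
  have h := contDiffOn_potential hf hlam hfA (n - 2)
    (isHomogeneousKernel_gradKernel (𝕜 := 𝕜) (E := EuclideanSpace ℝ (Fin n)) 0) (by simp; omega)
  have hd : ∀ x ∈ Metric.ball (0 : EuclideanSpace ℝ (Fin n)) 1,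
      HasFDerivAt (potential f (logKernel 𝕜) 0) (potential f (gradKernel 𝕜 0) 0 x) x :=
    fun x hx => hasFDerivAt_potential_logKernel hf (by simp; omega) hx
  have hn' : (n : WithTop ℕ∞) = ((n - 2 + 1 : ℕ) : WithTop ℕ∞) + 1 := by
    rw [← Nat.cast_succ]
    congr 1
    omega
  rw [hn', contDiffOn_succ_iff_fderiv_of_isOpen Metric.isOpen_ball]
  refine ⟨fun x hx => (hd x hx).differentiableAt.differentiableWithinAt, ?_, ?_⟩
  · intro h
    exact absurd h (by simp)
  · exact h.congr fun x hx => (hd x hx).fderiv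

end IteratedLaplacian

/-! ### Slicing space by parallel hyperplanes -/

section Slicing

variable {n : ℕ} {𝕜 : Type*} [RCLike 𝕜]

/-- The decomposition of the space into hyperplanes orthogonal to `θ`. -/
noncomputable def sliceEquiv (θ : Metric.sphere (0 : EuclideanSpace ℝ (Fin n)) 1) :
    ℝ × (Submodule.span ℝ {(θ : EuclideanSpace ℝ (Fin n))})ᗮ ≃ᵐ EuclideanSpace ℝ (Fin n) :=
  (((LinearIsometryEquiv.toSpanUnitSingleton (𝕜 := ℝ) (θ : EuclideanSpace ℝ (Fin n))
    (norm_eq_of_mem_sphere θ)).toMeasurableEquiv.prodCongr (MeasurableEquiv.refl _)).trans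
    (MeasurableEquiv.toLp 2 _)).trans
    (Submodule.orthogonalDecomposition
      (Submodule.span ℝ {(θ : EuclideanSpace ℝ (Fin n))})).symm.toMeasurableEquiv

lemma sliceEquiv_apply (θ : Metric.sphere (0 : EuclideanSpace ℝ (Fin n)) 1)
    (p : ℝ × (Submodule.span ℝ {(θ : EuclideanSpace ℝ (Fin n))})ᗮ) :
    sliceEquiv θ p = p.1 • (θ : EuclideanSpace ℝ (Fin n)) + p.2 := by
  simp only [sliceEquiv, MeasurableEquiv.trans_apply, LinearIsometryEquiv.coe_toMeasurableEquiv,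
    MeasurableEquiv.coe_toLp, Submodule.orthogonalDecomposition_symm_apply]
  rfl

lemma measurePreserving_sliceEquiv (θ : Metric.sphere (0 : EuclideanSpace ℝ (Fin n)) 1) :
    MeasurePreserving (sliceEquiv θ) (volume.prod volume) volume := by
  have h1 : MeasurePreserving (LinearIsometryEquiv.toSpanUnitSingleton (𝕜 := ℝ)
      (θ : EuclideanSpace ℝ (Fin n)) (norm_eq_of_mem_sphere θ)).toMeasurableEquiv volume volume :=
    LinearIsometryEquiv.measurePreserving _
  have h2 := h1.prod (MeasurePreserving.id
    (volume : Measure (Submodule.span ℝ {(θ : EuclideanSpace ℝ (Fin n))})ᗮ))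
  have h3 := WithLp.volume_preserving_toLp (Submodule.span ℝ {(θ : EuclideanSpace ℝ (Fin n))})
    (Submodule.span ℝ {(θ : EuclideanSpace ℝ (Fin n))})ᗮ
  have h4 := (Submodule.orthogonalDecomposition
    (Submodule.span ℝ {(θ : EuclideanSpace ℝ (Fin n))})).symm.measurePreserving
  exact h4.comp (h3.comp h2)

lemma inner_sliceEquiv (θ : Metric.sphere (0 : EuclideanSpace ℝ (Fin n)) 1) (t : ℝ)
    (y : (Submodule.span ℝ {(θ : EuclideanSpace ℝ (Fin n))})ᗮ) :
    ⟪t • (θ : EuclideanSpace ℝ (Fin n)) + y, (θ : EuclideanSpace ℝ (Fin n))⟫ = t := by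
  have h := (Submodule.mem_orthogonal_singleton_iff_inner_left).1 y.2
  rw [inner_add_left, h, real_inner_smul_left, real_inner_self_eq_norm_sq, norm_eq_of_mem_sphere]
  simp

lemma norm_sq_sliceEquiv (θ : Metric.sphere (0 : EuclideanSpace ℝ (Fin n)) 1) (t : ℝ)
    (y : (Submodule.span ℝ {(θ : EuclideanSpace ℝ (Fin n))})ᗮ) :
    ‖t • (θ : EuclideanSpace ℝ (Fin n)) + y‖ ^ 2 = t ^ 2 + ‖y‖ ^ 2 := by
  have h := (Submodule.mem_orthogonal_singleton_iff_inner_right).1 y.2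
  rw [norm_add_sq_real, real_inner_smul_left, h, norm_smul, norm_eq_of_mem_sphere]
  simp

lemma finrank_orthogonal_span_sphere (θ : Metric.sphere (0 : EuclideanSpace ℝ (Fin n)) 1) :
    Module.finrank ℝ (Submodule.span ℝ {(θ : EuclideanSpace ℝ (Fin n))})ᗮ = n - 1 := by
  have h0 : (θ : EuclideanSpace ℝ (Fin n)) ≠ 0 := by
    rw [← norm_pos_iff, norm_eq_of_mem_sphere]
    exact one_pos
  have h1 := (Submodule.span ℝ {(θ : EuclideanSpace ℝ (Fin n))}).finrank_add_finrank_orthogonal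
  rw [finrank_span_singleton h0, finrank_euclideanSpace_fin] at h1
  omega

/-- Fubini's theorem along the hyperplanes orthogonal to `θ`. -/
lemma integral_ridge_smul (θ : Metric.sphere (0 : EuclideanSpace ℝ (Fin n)) 1)
    (f : EuclideanSpace ℝ (Fin n) → 𝕜) (k : ℝ → ℝ)
    (h : Integrable fun y => k ⟪y, (θ : EuclideanSpace ℝ (Fin n))⟫ • f y) :
    ∫ y, k ⟪y, (θ : EuclideanSpace ℝ (Fin n))⟫ • f y = ∫ t, k t • radonTransform f θ t := by
  have hmp := measurePreserving_sliceEquiv θ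
  have hi := (hmp.integrable_comp_emb (sliceEquiv θ).measurableEmbedding).2 h
  rw [← hmp.integral_comp (sliceEquiv θ).measurableEmbedding]
  refine (integral_prod _ hi).trans ?_
  refine integral_congr_ae (Eventually.of_forall fun t => ?_)
  simp only [Function.comp_apply, sliceEquiv_apply, inner_sliceEquiv]
  rw [integral_smul, radonTransform]

lemma integrable_radonTransform (θ : Metric.sphere (0 : EuclideanSpace ℝ (Fin n)) 1)
    {f : EuclideanSpace ℝ (Fin n) → 𝕜} (h : Integrable f) : Integrable (radonTransform f θ) := by
  have hmp := measurePreserving_sliceEquiv θ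
  have hi := (hmp.integrable_comp_emb (sliceEquiv θ).measurableEmbedding).2 h
  refine hi.integral_prod_left.congr (Eventually.of_forall fun t => ?_)
  simp only [Function.comp_apply, sliceEquiv_apply, radonTransform]

lemma radonTransform_eq_zero {f : EuclideanSpace ℝ (Fin n) → 𝕜} {M : ℝ} (hf : IsBallDensity f M)
    (θ : Metric.sphere (0 : EuclideanSpace ℝ (Fin n)) 1) {t : ℝ} (ht : 1 < |t|) :
    radonTransform f θ t = 0 := by
  refine integral_eq_zero_of_ae (Eventually.of_forall fun y => hf.supp _ ?_)
  have h1 := norm_sq_sliceEquiv θ t y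
  have h2 : 1 < t ^ 2 := (one_lt_sq_iff_one_lt_abs t).2 ht
  nlinarith [norm_nonneg (t • (θ : EuclideanSpace ℝ (Fin n)) + (y : EuclideanSpace ℝ (Fin n))),
    sq_nonneg ‖y‖]

lemma norm_radon_integrand_le {f : EuclideanSpace ℝ (Fin n) → 𝕜} {M : ℝ} (hf : IsBallDensity f M)
    (θ : Metric.sphere (0 : EuclideanSpace ℝ (Fin n)) 1) (t : ℝ)
    (y : (Submodule.span ℝ {(θ : EuclideanSpace ℝ (Fin n))})ᗮ) :
    ‖f (t • (θ : EuclideanSpace ℝ (Fin n)) + y)‖ ≤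
      (Metric.closedBall (0 : (Submodule.span ℝ {(θ : EuclideanSpace ℝ (Fin n))})ᗮ) 1).indicator
        (fun _ => M) y := by
  by_cases hy : y ∈ Metric.closedBall (0 : (Submodule.span ℝ {(θ : EuclideanSpace ℝ (Fin n))})ᗮ) 1
  · rw [Set.indicator_of_mem hy]
    exact hf.bound _
  · rw [Set.indicator_of_notMem hy, hf.supp, norm_zero]
    simp only [mem_closedBall_zero_iff, not_le] at hy
    have h1 := norm_sq_sliceEquiv θ t y
    nlinarith [norm_nonneg (t • (θ : EuclideanSpace ℝ (Fin n)) + (y : EuclideanSpace ℝ (Fin n))),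
      sq_nonneg t]

lemma integrable_indicator_closedBall_orthogonal (M : ℝ)
    (θ : Metric.sphere (0 : EuclideanSpace ℝ (Fin n)) 1) :
    Integrable ((Metric.closedBall
      (0 : (Submodule.span ℝ {(θ : EuclideanSpace ℝ (Fin n))})ᗮ) 1).indicator fun _ => M) := by
  rw [integrable_indicator_iff Metric.isClosed_closedBall.measurableSet]
  exact integrableOn_const (isCompact_closedBall _ _).measure_lt_top.ne

/-- Every slice of the support lies in the unit ball of an `(n - 1)`-dimensional space, whose volume
is the same for all `θ`. This uniformity permits dominated convergence over the sphere. -/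
lemma exists_norm_radonTransform_le {f : EuclideanSpace ℝ (Fin n) → 𝕜} {M : ℝ} (hn : 2 ≤ n)
    (hf : IsBallDensity f M) : ∃ B, 0 ≤ B ∧ ∀ θ t, ‖radonTransform f θ t‖ ≤ B := by
  refine ⟨(ENNReal.ofReal ((√Real.pi) ^ (n - 1) / Real.Gamma (((n - 1 : ℕ) : ℝ) / 2 + 1))).toReal * M,
    mul_nonneg ENNReal.toReal_nonneg hf.nonneg, fun θ t => ?_⟩
  have : Nontrivial (Submodule.span ℝ {(θ : EuclideanSpace ℝ (Fin n))})ᗮ :=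
    Module.nontrivial_of_finrank_pos (R := ℝ) (by rw [finrank_orthogonal_span_sphere]; omega)
  refine (norm_integral_le_of_norm_le (integrable_indicator_closedBall_orthogonal M θ)
    (Eventually.of_forall (norm_radon_integrand_le hf θ t))).trans (le_of_eq ?_)
  rw [integral_indicator Metric.isClosed_closedBall.measurableSet, setIntegral_const,
    Measure.real, InnerProductSpace.volume_closedBall, finrank_orthogonal_span_sphere]
  simp

/-- The density may jump across the unit sphere, but a hyperplane with `|t| < 1` meets it in a
sphere of positive radius `√(1 - t ^ 2)`, a null set of the hyperplane. -/
lemma continuousAt_radonTransform {f : EuclideanSpace ℝ (Fin n) → 𝕜} {M : ℝ}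
    (hf : IsBallDensity f M) (hfm : Measurable f) (hfc : ∀ z, ‖z‖ ≠ 1 → ContinuousAt f z)
    (θ : Metric.sphere (0 : EuclideanSpace ℝ (Fin n)) 1) {t : ℝ} (ht : |t| < 1) :
    ContinuousAt (radonTransform f θ) t := by
  refine continuousAt_of_dominated (bound := (Metric.closedBall
      (0 : (Submodule.span ℝ {(θ : EuclideanSpace ℝ (Fin n))})ᗮ) 1).indicator fun _ => M)
    (Eventually.of_forall fun s => ?_)
    (Eventually.of_forall fun s => Eventually.of_forall (norm_radon_integrand_le hf θ s))
    (integrable_indicator_closedBall_orthogonal M θ) ?_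
  · exact (hfm.comp (by fun_prop)).aestronglyMeasurable
  · have h1 : 0 < 1 - t ^ 2 := by
      have := (sq_lt_one_iff_abs_lt_one t).2 ht
      linarith
    have h2 : ∀ᵐ y : (Submodule.span ℝ {(θ : EuclideanSpace ℝ (Fin n))})ᗮ,
        y ∉ Metric.sphere (0 : (Submodule.span ℝ {(θ : EuclideanSpace ℝ (Fin n))})ᗮ)
          (√(1 - t ^ 2)) := by
      rw [← measure_eq_zero_iff_ae_notMem]
      exact Measure.addHaar_sphere_of_ne_zero _ _ (Real.sqrt_pos.2 h1).ne'
    filter_upwards [h2] with y hy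
    have h3 : ‖t • (θ : EuclideanSpace ℝ (Fin n)) + (y : EuclideanSpace ℝ (Fin n))‖ ≠ 1 := by
      intro h
      apply hy
      have h4 := norm_sq_sliceEquiv θ t y
      rw [h] at h4
      rw [mem_sphere_zero_iff_norm, ← Real.sqrt_sq (norm_nonneg y)]
      congr 1
      linarith
    exact ContinuousAt.comp (f := fun s : ℝ => s • (θ : EuclideanSpace ℝ (Fin n)) + y)
      (hfc _ h3) (by fun_prop)

end Slicing

/-! ### Surface measure, rotations and moments on the sphere -/

section SphereIntegrals

open scoped ENNReal Pointwise

variable {n : ℕ}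

/-- Polar coordinates for nonnegative functions. -/
lemma lintegral_polar (hn : 1 ≤ n) {G : EuclideanSpace ℝ (Fin n) → ℝ≥0∞} (hG : Measurable G) :
    ∫⁻ x, G x = ∫⁻ θ : Metric.sphere (0 : EuclideanSpace ℝ (Fin n)) 1,
      (∫⁻ r in Set.Ioi (0 : ℝ), ENNReal.ofReal (r ^ (n - 1)) *
        G (r • (θ : EuclideanSpace ℝ (Fin n))))
      ∂(volume : Measure (EuclideanSpace ℝ (Fin n))).toSphere := by
  have := nontrivial_euclideanSpace hn
  have hmp := (volume : Measure (EuclideanSpace ℝ (Fin n))).measurePreserving_homeomorphUnitSphereProd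
  rw [finrank_euclideanSpace_fin] at hmp
  have h1 : ∫⁻ x, G x = ∫⁻ x : ({0}ᶜ : Set (EuclideanSpace ℝ (Fin n))), G x
      ∂((volume : Measure (EuclideanSpace ℝ (Fin n))).comap (↑)) := by
    rw [lintegral_subtype_comap (measurableSet_singleton _).compl, restrict_compl_singleton]
  have h2 : ∫⁻ x : ({0}ᶜ : Set (EuclideanSpace ℝ (Fin n))), G x
      ∂((volume : Measure (EuclideanSpace ℝ (Fin n))).comap (↑)) =
      ∫⁻ p : Metric.sphere (0 : EuclideanSpace ℝ (Fin n)) 1 × Set.Ioi (0 : ℝ),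
        G (p.2.1 • p.1.1)
        ∂((volume : Measure (EuclideanSpace ℝ (Fin n))).toSphere.prod
          (Measure.volumeIoiPow (n - 1))) := by
    rw [← hmp.lintegral_comp_emb (Homeomorph.measurableEmbedding _)]
    refine lintegral_congr fun x => ?_
    rw [← homeomorphUnitSphereProd_symm_apply_coe, Homeomorph.symm_apply_apply]
  rw [h1, h2, lintegral_prod _ (by fun_prop)]
  refine lintegral_congr fun θ => ?_
  rw [Measure.volumeIoiPow, lintegral_withDensity_eq_lintegral_mul _ (by fun_prop) (by fun_prop)]
  exact lintegral_subtype_comap measurableSet_Ioi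
    (fun r => ENNReal.ofReal (r ^ (n - 1)) * G (r • (θ : EuclideanSpace ℝ (Fin n))))

/-- The action of a linear isometry on the unit sphere. -/
noncomputable def sphereMap (R : EuclideanSpace ℝ (Fin n) ≃ₗᵢ[ℝ] EuclideanSpace ℝ (Fin n))
    (θ : Metric.sphere (0 : EuclideanSpace ℝ (Fin n)) 1) :
    Metric.sphere (0 : EuclideanSpace ℝ (Fin n)) 1 :=
  ⟨R θ, by simp⟩

/-- The surface measure of `s` is `n` times the volume of the cone `(0, 1) • s`, and linear
isometries preserve the volumes of cones. -/
lemma measurePreserving_sphereMap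
    (R : EuclideanSpace ℝ (Fin n) ≃ₗᵢ[ℝ] EuclideanSpace ℝ (Fin n)) :
    MeasurePreserving (sphereMap R) (volume : Measure (EuclideanSpace ℝ (Fin n))).toSphere
      (volume : Measure (EuclideanSpace ℝ (Fin n))).toSphere := by
  have hm : Measurable (sphereMap R) := by
    refine Measurable.subtype_mk ?_
    exact R.continuous.measurable.comp measurable_subtype_coe
  refine ⟨hm, Measure.ext fun s hs => ?_⟩
  rw [Measure.map_apply hm hs, Measure.toSphere_apply' _ hs, Measure.toSphere_apply' _ (hm hs)]
  congr 1
  rw [← R.measurePreserving.measure_preimage_emb R.toHomeomorph.measurableEmbedding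
    (Set.Ioo (0 : ℝ) 1 • (Subtype.val '' s))]
  congr 1
  ext x
  simp only [Set.mem_smul, Set.mem_image, Set.mem_preimage, exists_exists_and_eq_and]
  constructor
  · rintro ⟨r, hr, θ, hθ, rfl⟩
    exact ⟨r, hr, sphereMap R θ, hθ, by simp [sphereMap]⟩
  · rintro ⟨r, hr, θ, hθ, h⟩
    refine ⟨r, hr, sphereMap R.symm θ, ?_, ?_⟩
    · convert hθ
      ext1
      simp [sphereMap]
    · apply R.injective
      rw [← h]
      simp [sphereMap]

lemma exists_isometry_apply_eq {u v : EuclideanSpace ℝ (Fin n)} (h : ‖u‖ = ‖v‖) :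
    ∃ R : EuclideanSpace ℝ (Fin n) ≃ₗᵢ[ℝ] EuclideanSpace ℝ (Fin n), R u = v :=
  ⟨_, Submodule.reflection_sub h⟩

lemma measurableEmbedding_sphereMap
    (R : EuclideanSpace ℝ (Fin n) ≃ₗᵢ[ℝ] EuclideanSpace ℝ (Fin n)) :
    MeasurableEmbedding (sphereMap R) := by
  let e : Metric.sphere (0 : EuclideanSpace ℝ (Fin n)) 1 ≃ᵐ
      Metric.sphere (0 : EuclideanSpace ℝ (Fin n)) 1 :=
    { toFun := sphereMap R
      invFun := sphereMap R.symm
      left_inv := fun θ => by ext1; simp [sphereMap]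
      right_inv := fun θ => by ext1; simp [sphereMap]
      measurable_toFun := (measurePreserving_sphereMap R).measurable
      measurable_invFun := (measurePreserving_sphereMap R.symm).measurable }
  exact e.measurableEmbedding

/-- Integrals of ridge functions over the sphere do not depend on the direction of the ridge. -/
lemma integral_sphere_inner_congr {u v : EuclideanSpace ℝ (Fin n)} (h : ‖u‖ = ‖v‖)
    (k : ℝ → ℝ) :
    ∫ θ : Metric.sphere (0 : EuclideanSpace ℝ (Fin n)) 1,
      k ⟪u, (θ : EuclideanSpace ℝ (Fin n))⟫
      ∂(volume : Measure (EuclideanSpace ℝ (Fin n))).toSphere =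
    ∫ θ : Metric.sphere (0 : EuclideanSpace ℝ (Fin n)) 1,
      k ⟪v, (θ : EuclideanSpace ℝ (Fin n))⟫
      ∂(volume : Measure (EuclideanSpace ℝ (Fin n))).toSphere := by
  obtain ⟨R, rfl⟩ := exists_isometry_apply_eq h
  rw [← (measurePreserving_sphereMap R).integral_comp (measurableEmbedding_sphereMap R)
    fun θ => k ⟪R u, (θ : EuclideanSpace ℝ (Fin n))⟫]
  simp [sphereMap]

/-- The constant in `∫ |⟪u, θ⟫|^(s-1) dσ(θ) = sphereMoment n s * ‖u‖^(s-1)`. -/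
noncomputable def sphereMoment (n : ℕ) (s : ℝ) : ℝ :=
  2 * Real.pi ^ (((n - 1 : ℕ) : ℝ) / 2) * Real.Gamma (s / 2) / Real.Gamma (((n - 1 : ℕ) + s) / 2)

lemma lintegral_rpow_mul_exp_neg_sq {q : ℝ} (hq : -1 < q) :
    ∫⁻ r in Set.Ioi (0 : ℝ), ENNReal.ofReal (r ^ q * Real.exp (-r ^ 2)) =
      ENNReal.ofReal (Real.Gamma ((q + 1) / 2) / 2) := by
  have h := integral_rpow_mul_exp_neg_rpow (p := 2) (q := q) (by norm_num) hq
  have hi : IntegrableOn (fun r : ℝ => r ^ q * Real.exp (-r ^ (2 : ℝ))) (Set.Ioi 0) :=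
    integrableOn_rpow_mul_exp_neg_rpow hq (by norm_num)
  rw [one_div, inv_mul_eq_div] at h
  rw [← h, ofReal_integral_eq_lintegral_ofReal hi]
  · simp
  · filter_upwards [ae_restrict_mem measurableSet_Ioi] with r hr
    have : (0 : ℝ) < r := hr
    positivity

lemma lintegral_abs_rpow_mul_exp_neg_sq {q : ℝ} (hq : -1 < q) :
    ∫⁻ r : ℝ, ENNReal.ofReal (|r| ^ q * Real.exp (-r ^ 2)) =
      ENNReal.ofReal (Real.Gamma ((q + 1) / 2)) := by
  have hr : ∫⁻ r in Set.Ioi (0 : ℝ), ENNReal.ofReal (|r| ^ q * Real.exp (-r ^ 2)) =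
      ENNReal.ofReal (Real.Gamma ((q + 1) / 2) / 2) := by
    rw [← lintegral_rpow_mul_exp_neg_sq hq]
    refine setLIntegral_congr_fun measurableSet_Ioi fun r hr => ?_
    rw [abs_of_pos hr]
  have hl : ∫⁻ r in Set.Iio (0 : ℝ), ENNReal.ofReal (|r| ^ q * Real.exp (-r ^ 2)) =
      ENNReal.ofReal (Real.Gamma ((q + 1) / 2) / 2) := by
    rw [← hr, ← (Measure.measurePreserving_neg (volume : Measure ℝ)).setLIntegral_comp_preimage_emb
      (Homeomorph.neg ℝ).measurableEmbedding]
    have hset : (Neg.neg ⁻¹' Set.Iio (0 : ℝ)) = Set.Ioi 0 := by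
      ext r
      rw [Set.mem_preimage, Set.mem_Iio, Set.mem_Ioi, neg_lt_zero]
    rw [hset]
    refine lintegral_congr fun r => ?_
    rw [abs_neg, neg_sq]
  rw [← lintegral_add_compl _ (measurableSet_Ioi (a := (0 : ℝ))), hr, Set.compl_Ioi,
    setLIntegral_congr Iio_ae_eq_Iic.symm, hl, ← ENNReal.ofReal_add]
  · congr 1
    ring
  all_goals
    have := Real.Gamma_nonneg_of_nonneg (s := (q + 1) / 2) (by linarith)
    positivity

/-- Moments of linear functions over the sphere. -/
lemma lintegral_sphere_abs_inner_rpow (hn : 1 ≤ n) {s : ℝ} (hs : 0 < s)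
    {u : EuclideanSpace ℝ (Fin n)} (hu : u ≠ 0) :
    ∫⁻ θ : Metric.sphere (0 : EuclideanSpace ℝ (Fin n)) 1,
      ENNReal.ofReal (|⟪u, (θ : EuclideanSpace ℝ (Fin n))⟫| ^ (s - 1))
      ∂(volume : Measure (EuclideanSpace ℝ (Fin n))).toSphere =
    ENNReal.ofReal (sphereMoment n s * ‖u‖ ^ (s - 1)) := by
  have := nontrivial_euclideanSpace hn
  have hu' : 0 < ‖u‖ := norm_pos_iff.2 hu
  have hm1 : (0 : ℝ) ≤ (n - 1 : ℕ) := Nat.cast_nonneg _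
  let e : Metric.sphere (0 : EuclideanSpace ℝ (Fin n)) 1 := ⟨‖u‖⁻¹ • u, by simp [norm_smul, hu]⟩
  have hue : u = ‖u‖ • (e : EuclideanSpace ℝ (Fin n)) := by
    simp [e, smul_smul, hu]
  set K := ∫⁻ θ : Metric.sphere (0 : EuclideanSpace ℝ (Fin n)) 1,
      ENNReal.ofReal (|⟪(e : EuclideanSpace ℝ (Fin n)), (θ : EuclideanSpace ℝ (Fin n))⟫| ^ (s - 1))
      ∂(volume : Measure (EuclideanSpace ℝ (Fin n))).toSphere with hK
  have hKu : ∫⁻ θ : Metric.sphere (0 : EuclideanSpace ℝ (Fin n)) 1,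
      ENNReal.ofReal (|⟪u, (θ : EuclideanSpace ℝ (Fin n))⟫| ^ (s - 1))
      ∂(volume : Measure (EuclideanSpace ℝ (Fin n))).toSphere =
      ENNReal.ofReal (‖u‖ ^ (s - 1)) * K := by
    rw [hK, ← lintegral_const_mul _ (by fun_prop)]
    refine lintegral_congr fun θ => ?_
    rw [← ENNReal.ofReal_mul (by positivity)]
    congr 1
    conv_lhs => rw [hue]
    rw [real_inner_smul_left, abs_mul, abs_of_pos hu', Real.mul_rpow hu'.le (abs_nonneg _)]
  -- The Gaussian-weighted integral of `|⟪e, ξ⟫| ^ (s - 1)` is evaluated in polar coordinates and by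
  -- slicing along `e`; comparison yields the moment `K`. With lower integrals no integrability is
  -- needed beforehand, and finiteness comes out as a result.
  set G : EuclideanSpace ℝ (Fin n) → ℝ≥0∞ := fun ξ =>
    ENNReal.ofReal (|⟪(e : EuclideanSpace ℝ (Fin n)), ξ⟫| ^ (s - 1) * Real.exp (-‖ξ‖ ^ 2)) with hGdef
  have hG : Measurable G := by fun_prop
  have hpolar : ∫⁻ ξ, G ξ = K * ENNReal.ofReal (Real.Gamma (((n - 1 : ℕ) + s) / 2) / 2) := by
    have hg : ((n - 1 : ℕ) + s) / 2 = (((n - 1 : ℕ) : ℝ) + (s - 1) + 1) / 2 := by ring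
    rw [lintegral_polar hn hG, hg, ← lintegral_rpow_mul_exp_neg_sq (by linarith), hK,
      ← lintegral_mul_const _ (by fun_prop)]
    refine lintegral_congr fun θ => ?_
    rw [← lintegral_const_mul _ (by fun_prop)]
    refine setLIntegral_congr_fun measurableSet_Ioi fun r hr => ?_
    have hr' : (0 : ℝ) < r := hr
    simp only [hGdef]
    rw [← ENNReal.ofReal_mul (by positivity), ← ENNReal.ofReal_mul (by positivity)]
    congr 1
    rw [real_inner_smul_right, abs_mul, abs_of_pos hr', Real.mul_rpow hr'.le (abs_nonneg _),
      norm_smul, norm_eq_of_mem_sphere, mul_one, Real.norm_of_nonneg hr'.le, Real.rpow_add hr',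
      Real.rpow_natCast]
    ring
  have hslice : ∫⁻ ξ, G ξ =
      ENNReal.ofReal (Real.Gamma (s / 2) * Real.pi ^ (((n - 1 : ℕ) : ℝ) / 2)) := by
    have hgauss : ∫⁻ y : (Submodule.span ℝ {(e : EuclideanSpace ℝ (Fin n))})ᗮ,
        ENNReal.ofReal (Real.exp (-‖y‖ ^ 2)) =
          ENNReal.ofReal (Real.pi ^ (((n - 1 : ℕ) : ℝ) / 2)) := by
      have h1 := GaussianFourier.integral_rexp_neg_mul_sq_norm
        (V := (Submodule.span ℝ {(e : EuclideanSpace ℝ (Fin n))})ᗮ) one_pos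
      rw [finrank_orthogonal_span_sphere, div_one] at h1
      simp only [neg_mul, one_mul] at h1
      rw [← h1, ofReal_integral_eq_lintegral_ofReal]
      · by_contra hni
        rw [integral_undef hni] at h1
        have : 0 < Real.pi ^ (((n - 1 : ℕ) : ℝ) / 2) := by positivity
        linarith
      · exact Eventually.of_forall fun y => (Real.exp_pos _).le
    rw [← (measurePreserving_sliceEquiv e).lintegral_comp_emb (sliceEquiv e).measurableEmbedding,
      lintegral_prod _ (by fun_prop)]
    have h2 : s / 2 = ((s - 1) + 1) / 2 := by ring
    rw [ENNReal.ofReal_mul (Real.Gamma_nonneg_of_nonneg (by positivity)), h2,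
      ← lintegral_abs_rpow_mul_exp_neg_sq (by linarith), ← hgauss,
      ← lintegral_mul_const _ (by fun_prop)]
    refine lintegral_congr fun t => ?_
    rw [← lintegral_const_mul _ (by fun_prop)]
    refine lintegral_congr fun y => ?_
    simp only [hGdef, sliceEquiv_apply]
    rw [real_inner_comm, inner_sliceEquiv, norm_sq_sliceEquiv, ← ENNReal.ofReal_mul (by positivity)]
    congr 1
    rw [neg_add, Real.exp_add, mul_assoc]
  have hΓ : 0 < Real.Gamma (((n - 1 : ℕ) + s) / 2) := Real.Gamma_pos_of_pos (by positivity)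
  have hKval : K = ENNReal.ofReal (sphereMoment n s) := by
    have h1 := hpolar.symm.trans hslice
    have h2 : ENNReal.ofReal (Real.Gamma (((n - 1 : ℕ) + s) / 2) / 2) ≠ 0 := by
      simpa using by positivity
    rw [← ENNReal.mul_left_inj h2 ENNReal.ofReal_ne_top, h1, ← ENNReal.ofReal_mul']
    · congr 1
      rw [sphereMoment]
      field_simp
    · positivity
  rw [hKu, hKval, mul_comm, ENNReal.ofReal_mul']
  positivity

end SphereIntegrals

/-! ### Power weights approximating the Dirac mass on the line -/

section PowerPeak

variable {𝕜 : Type*} [RCLike 𝕜]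

lemma integrableOn_abs_rpow {s : ℝ} (hs : 0 < s) (R : ℝ) :
    IntegrableOn (fun u : ℝ => |u| ^ (s - 1)) (Metric.closedBall 0 R) := by
  have := integrableOn_norm_rpow_neg (E := ℝ) (a := 1 - s) (by simpa using hs) R
  simpa using this

/-- The factor `s / 2` gives mass exactly one on `[-1, 1]` for every `s`. -/
lemma setIntegral_abs_rpow {s : ℝ} (hs : 0 < s) {R : ℝ} (hR : 0 < R) :
    ∫ u in Metric.closedBall (0 : ℝ) R, s / 2 * |u| ^ (s - 1) = R ^ s := by
  have h1 : ∫ u in Metric.closedBall (0 : ℝ) R, s / 2 * |u| ^ (s - 1) =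
      ∫ u : ℝ, (Set.Iic R).indicator (fun u => s / 2 * u ^ (s - 1)) |u| := by
    rw [← integral_indicator Metric.isClosed_closedBall.measurableSet]
    congr 1
    ext u
    simp [Set.indicator]
  rw [h1, integral_comp_abs (f := (Set.Iic R).indicator (fun u => s / 2 * u ^ (s - 1))),
    setIntegral_indicator measurableSet_Iic, Set.Ioi_inter_Iic,
    ← intervalIntegral.integral_of_le hR.le, intervalIntegral.integral_const_mul,
    integral_rpow (Or.inl (by linarith)), sub_add_cancel, Real.zero_rpow hs.ne']
  field_simp
  ring

/-- The kernels `(s / 2) |u|^(s - 1)` concentrate at the origin as `s → 0`. -/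
lemma tendsto_integral_abs_rpow_smul {h : ℝ → 𝕜} (hi : Integrable h)
    (h0 : ∀ u, 2 < |u| → h u = 0) (hc : ContinuousAt h 0) :
    Tendsto (fun k => ∫ u, (regParam k / 2 * |u| ^ (regParam k - 1)) • h u) atTop (𝓝 (h 0)) := by
  have key : Tendsto (fun k => ∫ u in Metric.closedBall (0 : ℝ) 2,
      (regParam k / 2 * |u| ^ (regParam k - 1)) • h u) atTop (𝓝 (h 0)) := by
    refine tendsto_setIntegral_peak_smul_of_integrableOn_of_tendsto (x₀ := (0 : ℝ))
      (t := Metric.closedBall 0 1) Metric.isClosed_closedBall.measurableSet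
      Metric.isClosed_closedBall.measurableSet (Metric.closedBall_subset_closedBall (by norm_num))
      (mem_nhdsWithin_of_mem_nhds (Metric.closedBall_mem_nhds 0 one_pos))
      (isCompact_closedBall _ _).measure_lt_top.ne ?_ ?_ ?_ ?_ hi.integrableOn
      (hc.tendsto.mono_left nhdsWithin_le_nhds)
    · refine Eventually.of_forall fun k u _ => ?_
      have := regParam_pos k
      positivity
    · intro U hU h0U
      obtain ⟨δ, hδ, hδU⟩ := Metric.isOpen_iff.1 hU 0 h0U
      rw [Metric.tendstoUniformlyOn_iff]
      intro e he
      -- With a base at most `1`, the varying exponent `s - 1 ≥ -1` may be replaced by `-1`, so the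
      -- bound is uniform in `s`.
      set δ' := min δ 1 with hδ'
      have hδ0 : 0 < δ' := lt_min hδ one_pos
      have hlim : Tendsto (fun k => regParam k / 2 * δ'⁻¹) atTop (𝓝 0) := by
        simpa using (tendsto_regParam.div_const 2).mul_const δ'⁻¹
      filter_upwards [(tendsto_order.1 hlim).2 e he] with k hk u hu
      have hs := regParam_pos k
      have hs1 := regParam_le_one k
      have hu1 : δ' ≤ |u| := by
        by_contra hlt
        push Not at hlt
        exact hu.2 (hδU (by simpa using lt_of_lt_of_le hlt (min_le_left _ _)))
      rw [Pi.zero_apply, dist_zero_left, Real.norm_of_nonneg (by positivity)]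
      refine lt_of_le_of_lt (mul_le_mul_of_nonneg_left ?_ (by positivity)) hk
      calc |u| ^ (regParam k - 1) ≤ δ' ^ (regParam k - 1) :=
            Real.rpow_le_rpow_of_nonpos hδ0 hu1 (by linarith)
        _ ≤ δ' ^ (-1 : ℝ) :=
            Real.rpow_le_rpow_of_exponent_ge hδ0 (min_le_right _ _) (by linarith)
        _ = δ'⁻¹ := Real.rpow_neg_one _
    · simp_rw [fun k => setIntegral_abs_rpow (regParam_pos k) one_pos, Real.one_rpow]
      exact tendsto_const_nhds
    · refine Eventually.of_forall fun k => ?_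
      exact Measurable.aestronglyMeasurable (by fun_prop)
  refine key.congr fun k => ?_
  refine setIntegral_eq_integral_of_forall_compl_eq_zero fun u hu => ?_
  rw [h0 u (by simpa using hu), smul_zero]

/-- The weighted integrals are bounded uniformly. -/
lemma norm_integral_abs_rpow_smul_le {h : ℝ → 𝕜} {B : ℝ} (hB : ∀ u, ‖h u‖ ≤ B)
    (h0 : ∀ u, 2 < |u| → h u = 0) (k : ℕ) :
    ‖∫ u, (regParam k / 2 * |u| ^ (regParam k - 1)) • h u‖ ≤ 2 * B := by
  have hs := regParam_pos k
  have hB0 : 0 ≤ B := (norm_nonneg _).trans (hB 0)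
  have hi := ((integrableOn_abs_rpow hs 2).const_mul (regParam k / 2)).mul_const B
  have h1 : ‖∫ u, (regParam k / 2 * |u| ^ (regParam k - 1)) • h u‖ ≤
      ∫ u in Metric.closedBall (0 : ℝ) 2, regParam k / 2 * |u| ^ (regParam k - 1) * B := by
    rw [← setIntegral_eq_integral_of_forall_compl_eq_zero (s := Metric.closedBall (0 : ℝ) 2)
      fun u hu => by rw [h0 u (by simpa using hu), smul_zero]]
    refine norm_integral_le_of_norm_le hi (Eventually.of_forall fun u => ?_)
    rw [norm_smul, Real.norm_of_nonneg (by positivity)]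
    exact mul_le_mul_of_nonneg_left (hB u) (by positivity)
  refine h1.trans ?_
  rw [integral_mul_const, setIntegral_abs_rpow hs two_pos]
  refine mul_le_mul_of_nonneg_right ?_ hB0
  calc (2 : ℝ) ^ regParam k ≤ 2 ^ (1 : ℝ) :=
        Real.rpow_le_rpow_of_exponent_le one_le_two (regParam_le_one k)
    _ = 2 := Real.rpow_one 2

end PowerPeak

/-! ### Backprojection as a Riesz potential -/

section Backprojection

variable {n : ℕ} {𝕜 : Type*} [RCLike 𝕜]

lemma sphereMoment_pos {s : ℝ} (hs : 0 < s) : 0 < sphereMoment n s := by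
  have h1 : 0 < Real.Gamma (s / 2) := Real.Gamma_pos_of_pos (by positivity)
  have h2 : 0 < Real.Gamma (((n - 1 : ℕ) + s) / 2) := Real.Gamma_pos_of_pos (by positivity)
  rw [sphereMoment]
  positivity

lemma integrable_sphere_abs_inner_rpow (hn : 1 ≤ n) {s : ℝ} (hs : 0 < s)
    {u : EuclideanSpace ℝ (Fin n)} (hu : u ≠ 0) :
    Integrable (fun θ : Metric.sphere (0 : EuclideanSpace ℝ (Fin n)) 1 =>
      |⟪u, (θ : EuclideanSpace ℝ (Fin n))⟫| ^ (s - 1))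
      (volume : Measure (EuclideanSpace ℝ (Fin n))).toSphere := by
  refine ⟨Measurable.aestronglyMeasurable (by fun_prop), ?_⟩
  rw [hasFiniteIntegral_iff_ofReal (Eventually.of_forall fun θ => by positivity),
    lintegral_sphere_abs_inner_rpow hn hs hu]
  exact ENNReal.ofReal_lt_top

lemma integral_sphere_abs_inner_rpow (hn : 1 ≤ n) {s : ℝ} (hs : 0 < s)
    {u : EuclideanSpace ℝ (Fin n)} (hu : u ≠ 0) :
    ∫ θ : Metric.sphere (0 : EuclideanSpace ℝ (Fin n)) 1,
      |⟪u, (θ : EuclideanSpace ℝ (Fin n))⟫| ^ (s - 1)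
      ∂(volume : Measure (EuclideanSpace ℝ (Fin n))).toSphere =
    sphereMoment n s * ‖u‖ ^ (s - 1) := by
  rw [integral_eq_lintegral_of_nonneg_ae (Eventually.of_forall fun θ => by positivity)
    (Measurable.aestronglyMeasurable (by fun_prop)), lintegral_sphere_abs_inner_rpow hn hs hu,
    ENNReal.toReal_ofReal]
  have := sphereMoment_pos (n := n) hs
  positivity

lemma integrable_norm_rpow_smul (hn : 1 ≤ n) {f : EuclideanSpace ℝ (Fin n) → 𝕜} {M : ℝ}
    (hf : IsBallDensity f M) {a : ℝ} (ha : a < n) {x : EuclideanSpace ℝ (Fin n)}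
    (hx : x ∈ Metric.ball (0 : EuclideanSpace ℝ (Fin n)) 1) :
    Integrable (fun y => ‖x - y‖ ^ (-a) • f y) := by
  have := nontrivial_euclideanSpace hn
  have h1 : Integrable (fun z => ‖z‖ ^ (-a) • f (x - z)) := by
    have hb : Integrable ((Metric.closedBall (0 : EuclideanSpace ℝ (Fin n)) 2).indicator
        (fun z => ‖z‖ ^ (-a) * M)) := by
      rw [integrable_indicator_iff Metric.isClosed_closedBall.measurableSet]
      exact (integrableOn_norm_rpow_neg (by simpa using ha) 2).mul_const _
    have hm : Measurable fun z : EuclideanSpace ℝ (Fin n) => ‖z‖ ^ (-a) := by fun_prop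
    refine hb.mono' (hm.aestronglyMeasurable.smul (hf.meas_sub x))
      (Eventually.of_forall fun z => ?_)
    by_cases h : z ∈ Metric.closedBall (0 : EuclideanSpace ℝ (Fin n)) 2
    · rw [Set.indicator_of_mem h, norm_smul, Real.norm_of_nonneg (by positivity)]
      exact mul_le_mul_of_nonneg_left (hf.bound _) (by positivity)
    · rw [Set.indicator_of_notMem h, hf.supp, smul_zero, norm_zero]
      simp only [mem_closedBall_zero_iff, not_le, mem_ball_zero_iff] at h hx
      have := norm_sub_norm_le z x
      rw [norm_sub_rev]
      linarith
  simpa using h1.comp_sub_left x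

lemma ae_ne (hn : 1 ≤ n) (x : EuclideanSpace ℝ (Fin n)) : ∀ᵐ y, x - y ≠ 0 := by
  have := nontrivial_euclideanSpace hn
  have h : ∀ᵐ y : EuclideanSpace ℝ (Fin n), y ≠ x := by
    rw [ae_iff]
    simp
  filter_upwards [h] with y hy
  exact sub_ne_zero.2 hy.symm

/-- By Tonelli it suffices to integrate in `θ` first: the moment formula turns the integrand into a
multiple of `‖x - y‖ ^ (s - 1) * ‖f y‖`, which is integrable. -/
lemma integrable_prod_abs_inner_rpow (hn : 1 ≤ n) {f : EuclideanSpace ℝ (Fin n) → 𝕜} {M : ℝ}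
    (hf : IsBallDensity f M) {s : ℝ} (hs : 0 < s) {x : EuclideanSpace ℝ (Fin n)}
    (hx : x ∈ Metric.ball (0 : EuclideanSpace ℝ (Fin n)) 1) :
    Integrable (fun p : Metric.sphere (0 : EuclideanSpace ℝ (Fin n)) 1 × EuclideanSpace ℝ (Fin n) =>
      |⟪x - p.2, (p.1 : EuclideanSpace ℝ (Fin n))⟫| ^ (s - 1) • f p.2)
      ((volume : Measure (EuclideanSpace ℝ (Fin n))).toSphere.prod volume) := by
  have hm : Measurable fun p : Metric.sphere (0 : EuclideanSpace ℝ (Fin n)) 1 ×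
      EuclideanSpace ℝ (Fin n) => |⟪x - p.2, (p.1 : EuclideanSpace ℝ (Fin n))⟫| ^ (s - 1) := by
    fun_prop
  have hm2 : AEStronglyMeasurable (fun p : Metric.sphere (0 : EuclideanSpace ℝ (Fin n)) 1 ×
      EuclideanSpace ℝ (Fin n) => f p.2)
      ((volume : Measure (EuclideanSpace ℝ (Fin n))).toSphere.prod volume) :=
    hf.meas.comp_snd
  have hm3 : AEStronglyMeasurable (fun p : Metric.sphere (0 : EuclideanSpace ℝ (Fin n)) 1 ×
      EuclideanSpace ℝ (Fin n) => |⟪x - p.2, (p.1 : EuclideanSpace ℝ (Fin n))⟫| ^ (s - 1) • f p.2)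
      ((volume : Measure (EuclideanSpace ℝ (Fin n))).toSphere.prod volume) :=
    hm.aestronglyMeasurable.smul hm2
  rw [integrable_prod_iff' hm3]
  constructor
  · filter_upwards [ae_ne hn x] with y hy
    exact (integrable_sphere_abs_inner_rpow hn hs hy).smul_const (f y)
  · have h1 := ((integrable_norm_rpow_smul hn hf (a := 1 - s)
      (by have : (1 : ℝ) ≤ n := by exact_mod_cast hn
          linarith) hx).norm).const_mul (sphereMoment n s)
    refine h1.congr ?_
    filter_upwards [ae_ne hn x] with y hy
    simp only [norm_smul]
    rw [integral_mul_const]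
    simp_rw [Real.norm_of_nonneg (Real.rpow_nonneg (abs_nonneg _) _)]
    rw [integral_sphere_abs_inner_rpow hn hs hy, Real.norm_of_nonneg (by positivity), neg_sub,
      mul_assoc]

lemma continuousAt_Gamma_of_pos {t : ℝ} (ht : 0 < t) : ContinuousAt Real.Gamma t :=
  (Real.differentiableAt_Gamma fun m => by
    have : (0 : ℝ) ≤ m := Nat.cast_nonneg m
    linarith).continuousAt

/-- The factor `s / 2` cancels the simple pole of `Γ(s / 2)` at `0`, because `(s / 2) Γ(s / 2) = Γ(s
/ 2 + 1) → 1`. -/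
lemma tendsto_regParam_mul_sphereMoment (hn : 2 ≤ n) :
    Tendsto (fun k => regParam k / 2 * sphereMoment n (regParam k)) atTop
      (𝓝 (2 * Real.pi ^ (((n - 1 : ℕ) : ℝ) / 2) / Real.Gamma (((n - 1 : ℕ) : ℝ) / 2))) := by
  have hm : (0 : ℝ) < (n - 1 : ℕ) := by
    have : 0 < n - 1 := by omega
    exact_mod_cast this
  have h1 : Tendsto (fun k => Real.Gamma (regParam k / 2 + 1)) atTop (𝓝 1) := by
    have hc : ContinuousAt Real.Gamma 1 :=
      continuousAt_Gamma_of_pos one_pos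
    have h2 : Tendsto (fun k => regParam k / 2 + 1) atTop (𝓝 1) := by
      simpa using (tendsto_regParam.div_const 2).add_const 1
    simpa [Function.comp_def] using hc.tendsto.comp h2
  have h3 : Tendsto (fun k => Real.Gamma (((n - 1 : ℕ) + regParam k) / 2)) atTop
      (𝓝 (Real.Gamma (((n - 1 : ℕ) : ℝ) / 2))) := by
    have hc : ContinuousAt Real.Gamma (((n - 1 : ℕ) : ℝ) / 2) :=
      continuousAt_Gamma_of_pos (by positivity)
    have h2 : Tendsto (fun k => ((n - 1 : ℕ) + regParam k) / 2) atTop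
        (𝓝 (((n - 1 : ℕ) : ℝ) / 2)) := by
      simpa using (tendsto_regParam.const_add ((n - 1 : ℕ) : ℝ)).div_const 2
    exact hc.tendsto.comp h2
  have h4 := (h1.const_mul (2 * Real.pi ^ (((n - 1 : ℕ) : ℝ) / 2))).div h3
    (Real.Gamma_pos_of_pos (by positivity)).ne'
  rw [mul_one] at h4
  refine h4.congr fun k => ?_
  have := regParam_pos k
  simp only [Pi.div_apply]
  rw [Real.Gamma_add_one (by positivity), sphereMoment]
  ring

/-- The dual Radon transform of the Radon transform is a Riesz potential. -/
theorem integral_sphere_radonTransform (hn : 2 ≤ n) {f : EuclideanSpace ℝ (Fin n) → 𝕜} {M : ℝ}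
    (hf : IsBallDensity f M) (hfm : Measurable f) (hfc : ∀ z, ‖z‖ ≠ 1 → ContinuousAt f z)
    {x : EuclideanSpace ℝ (Fin n)} (hx : x ∈ Metric.ball (0 : EuclideanSpace ℝ (Fin n)) 1) :
    ∫ θ : Metric.sphere (0 : EuclideanSpace ℝ (Fin n)) 1,
      radonTransform f θ ⟪x, (θ : EuclideanSpace ℝ (Fin n))⟫
      ∂(volume : Measure (EuclideanSpace ℝ (Fin n))).toSphere =
    (2 * Real.pi ^ (((n - 1 : ℕ) : ℝ) / 2) / Real.Gamma (((n - 1 : ℕ) : ℝ) / 2)) •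
      ∫ y, ‖x - y‖⁻¹ • f y := by
  have hn1 : 1 ≤ n := by omega
  obtain ⟨B, hB0, hB⟩ := exists_norm_radonTransform_le hn hf
  have hx1 : ‖x‖ < 1 := by simpa using hx
  have hin : ∀ θ : Metric.sphere (0 : EuclideanSpace ℝ (Fin n)) 1,
      |⟪x, (θ : EuclideanSpace ℝ (Fin n))⟫| < 1 := by
    intro θ
    refine (abs_real_inner_le_norm _ _).trans_lt ?_
    rwa [norm_eq_of_mem_sphere, mul_one]
  set F : ℕ → Metric.sphere (0 : EuclideanSpace ℝ (Fin n)) 1 → 𝕜 := fun k θ =>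
    (regParam k / 2) • ∫ y, |⟪x - y, (θ : EuclideanSpace ℝ (Fin n))⟫| ^ (regParam k - 1) • f y
    with hF
  have hprod := fun k => integrable_prod_abs_inner_rpow hn1 hf (regParam_pos k) hx
  -- Fubini supplies integrability of the ridge function for almost every `θ` only; countably many
  -- `k` share one null set.
  have hFeq : ∀ᵐ θ ∂(volume : Measure (EuclideanSpace ℝ (Fin n))).toSphere, ∀ k, F k θ =
      ∫ u, (regParam k / 2 * |u| ^ (regParam k - 1)) •
        radonTransform f θ (⟪x, (θ : EuclideanSpace ℝ (Fin n))⟫ - u) := by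
    rw [ae_all_iff]
    intro k
    filter_upwards [(hprod k).prod_right_ae] with θ hθ
    have h1 := integral_ridge_smul θ f
      (fun t => |⟪x, (θ : EuclideanSpace ℝ (Fin n))⟫ - t| ^ (regParam k - 1))
      (by simpa only [inner_sub_left] using hθ)
    simp only [hF, inner_sub_left]
    rw [h1, ← integral_smul, ← integral_sub_left_eq_self _ volume
      ⟪x, (θ : EuclideanSpace ℝ (Fin n))⟫]
    simp only [sub_sub_cancel, smul_smul]
  have hzero : ∀ (θ : Metric.sphere (0 : EuclideanSpace ℝ (Fin n)) 1) (u : ℝ), 2 < |u| →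
      radonTransform f θ (⟪x, (θ : EuclideanSpace ℝ (Fin n))⟫ - u) = 0 := by
    intro θ u hu
    refine radonTransform_eq_zero hf θ ?_
    have h1 := abs_sub_abs_le_abs_sub u ⟪x, (θ : EuclideanSpace ℝ (Fin n))⟫
    rw [abs_sub_comm] at h1
    linarith [hin θ]
  -- For fixed `θ` the weight concentrates at `u = 0` and recovers the Radon transform at `⟪x, θ⟫`,
  -- which lies in `(-1, 1)`, where it is continuous.
  have lim1 : Tendsto (fun k => ∫ θ, F k θ
      ∂(volume : Measure (EuclideanSpace ℝ (Fin n))).toSphere) atTop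
      (𝓝 (∫ θ : Metric.sphere (0 : EuclideanSpace ℝ (Fin n)) 1,
        radonTransform f θ ⟪x, (θ : EuclideanSpace ℝ (Fin n))⟫
        ∂(volume : Measure (EuclideanSpace ℝ (Fin n))).toSphere)) := by
    refine tendsto_integral_of_dominated_convergence (fun _ => 2 * B) (fun k => ?_)
      (integrable_const _) (fun k => ?_) ?_
    · exact (hprod k).integral_prod_left.1.const_smul _
    · filter_upwards [hFeq] with θ hθ
      rw [hθ k]
      exact norm_integral_abs_rpow_smul_le (fun u => hB θ _) (hzero θ) k
    · filter_upwards [hFeq] with θ hθ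
      simp_rw [hθ]
      have hc : ContinuousAt (fun u : ℝ =>
          radonTransform f θ (⟪x, (θ : EuclideanSpace ℝ (Fin n))⟫ - u)) 0 := by
        have hsub : ContinuousAt (fun u : ℝ => ⟪x, (θ : EuclideanSpace ℝ (Fin n))⟫ - u) 0 :=
          (continuous_const.sub continuous_id).continuousAt
        exact (continuousAt_radonTransform hf hfm hfc θ (hin θ)).comp_of_eq hsub (sub_zero _)
      simpa using tendsto_integral_abs_rpow_smul
        ((integrable_radonTransform θ hf.integrable).comp_sub_left _) (hzero θ) hc
  -- Integrating over `θ` first evaluates the same quantity by the moment formula.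
  have hswap : ∀ k, ∫ θ, F k θ ∂(volume : Measure (EuclideanSpace ℝ (Fin n))).toSphere =
      (regParam k / 2 * sphereMoment n (regParam k)) •
        ∫ y, ‖x - y‖ ^ (regParam k - 1) • f y := by
    intro k
    simp only [hF]
    rw [integral_smul, integral_integral_swap (hprod k), mul_smul,
      ← integral_smul (sphereMoment n (regParam k))]
    congr 1
    refine integral_congr_ae ?_
    filter_upwards [ae_ne hn1 x] with y hy
    rw [integral_smul_const, integral_sphere_abs_inner_rpow hn1 (regParam_pos k) hy, mul_smul]
  have lim2 : Tendsto (fun k => ∫ y, ‖x - y‖ ^ (regParam k - 1) • f y) atTop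
      (𝓝 (∫ y, ‖x - y‖⁻¹ • f y)) := by
    have hi := ((integrable_norm_rpow_smul hn1 hf (a := 1) (by exact_mod_cast hn) hx).norm).const_mul 2
    refine tendsto_integral_of_dominated_convergence _ (fun k => ?_) hi (fun k => ?_) ?_
    · have hm : Measurable fun y : EuclideanSpace ℝ (Fin n) => ‖x - y‖ ^ (regParam k - 1) := by
        fun_prop
      exact hm.aestronglyMeasurable.smul hf.meas
    · filter_upwards [ae_ne hn1 x] with y hy
      have hpos : 0 < ‖x - y‖ := norm_pos_iff.2 hy
      have hs := regParam_pos k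
      have hs1 := regParam_le_one k
      by_cases hy1 : 1 < ‖y‖
      · simp [hf.supp y hy1]
      · push Not at hy1
        have hle : ‖x - y‖ ≤ 2 := (norm_sub_le x y).trans (by linarith)
        rw [norm_smul, norm_smul, Real.norm_of_nonneg (by positivity),
          Real.norm_of_nonneg (by positivity), ← mul_assoc]
        refine mul_le_mul_of_nonneg_right ?_ (norm_nonneg _)
        rw [sub_eq_add_neg (regParam k), Real.rpow_add hpos]
        refine mul_le_mul_of_nonneg_right ?_ (by positivity)
        calc ‖x - y‖ ^ regParam k ≤ 2 ^ regParam k := Real.rpow_le_rpow hpos.le hle hs.le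
          _ ≤ 2 ^ (1 : ℝ) := Real.rpow_le_rpow_of_exponent_le one_le_two hs1
          _ = 2 := Real.rpow_one 2
    · filter_upwards [ae_ne hn1 x] with y hy
      have hpos : 0 < ‖x - y‖ := norm_pos_iff.2 hy
      have h1 : Tendsto (fun k => ‖x - y‖ ^ (regParam k - 1)) atTop (𝓝 (‖x - y‖ ^ ((0 : ℝ) - 1))) :=
        (Real.continuousAt_const_rpow hpos.ne').tendsto.comp (tendsto_regParam.sub_const 1)
      rw [zero_sub, Real.rpow_neg_one] at h1
      exact h1.smul_const _
  refine tendsto_nhds_unique lim1 ?_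
  simp_rw [hswap]
  exact (tendsto_regParam_mul_sphereMoment hn).smul lim2

end Backprojection

/-! ### Backprojection of the logarithmic transform -/

section LogBackprojection

variable {n : ℕ} {𝕜 : Type*} [RCLike 𝕜]

/-- The exponent `-1/2` is the case `s = 1/2` of the power weights, so their integrability results
dominate the logarithm too. -/
lemma abs_log_le_four_mul_rpow {a : ℝ} (ha : |a| ≤ 2) :
    |Real.log a| ≤ 4 * |a| ^ (-(1 / 2) : ℝ) := by
  rcases eq_or_ne a 0 with rfl | h0
  · simp
  have hpos : 0 < |a| := abs_pos.2 h0
  have h1 : 1 / 2 ≤ |a| ^ (-(1 / 2) : ℝ) := by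
    calc (1 / 2 : ℝ) = 2 ^ (-1 : ℝ) := by rw [Real.rpow_neg_one]; norm_num
      _ ≤ 2 ^ (-(1 / 2) : ℝ) := Real.rpow_le_rpow_of_exponent_le one_le_two (by norm_num)
      _ ≤ |a| ^ (-(1 / 2) : ℝ) := Real.rpow_le_rpow_of_nonpos hpos ha (by norm_num)
  rw [← Real.log_abs, abs_le]
  constructor
  · have h2 := Real.log_le_sub_one_of_pos (Real.rpow_pos_of_pos hpos (-(1 / 2)))
    rw [Real.log_rpow hpos] at h2
    linarith
  · have h2 := Real.log_le_sub_one_of_pos hpos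
    linarith

lemma ae_inner_sphere_ne_zero {u : EuclideanSpace ℝ (Fin n)} (hu : u ≠ 0) :
    ∀ᵐ θ : Metric.sphere (0 : EuclideanSpace ℝ (Fin n)) 1
      ∂(volume : Measure (EuclideanSpace ℝ (Fin n))).toSphere,
      ⟪u, (θ : EuclideanSpace ℝ (Fin n))⟫ ≠ 0 := by
  rw [ae_iff, Measure.toSphere_apply' _ (by measurability)]
  have h1 : volume ((Submodule.span ℝ {u})ᗮ : Set (EuclideanSpace ℝ (Fin n))) = 0 := by
    refine Measure.addHaar_submodule _ _ ?_
    rw [Ne, Submodule.orthogonal_eq_top_iff, Submodule.span_singleton_eq_bot]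
    exact hu
  rw [measure_mono_null _ h1, mul_zero]
  rintro _ ⟨r, -, _, ⟨θ, hθ, rfl⟩, rfl⟩
  rw [SetLike.mem_coe, Submodule.mem_orthogonal_singleton_iff_inner_right]
  simp only [ne_eq, not_not, Set.mem_ofPred_eq] at hθ
  simp [real_inner_smul_right, hθ]

lemma integrable_sphere_log_inner (hn : 1 ≤ n) {u : EuclideanSpace ℝ (Fin n)} (hu : ‖u‖ = 1) :
    Integrable (fun θ : Metric.sphere (0 : EuclideanSpace ℝ (Fin n)) 1 =>
      Real.log ⟪u, (θ : EuclideanSpace ℝ (Fin n))⟫)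
      (volume : Measure (EuclideanSpace ℝ (Fin n))).toSphere := by
  have hu0 : u ≠ 0 := by
    rw [← norm_pos_iff, hu]
    exact one_pos
  have h1 := (integrable_sphere_abs_inner_rpow hn (s := 1 / 2) (by norm_num) hu0).const_mul 4
  refine h1.mono' (Measurable.aestronglyMeasurable (by fun_prop)) (Eventually.of_forall fun θ => ?_)
  rw [Real.norm_eq_abs]
  refine (abs_log_le_four_mul_rpow ?_).trans_eq (by norm_num)
  refine (abs_real_inner_le_norm _ _).trans ?_
  rw [hu, norm_eq_of_mem_sphere]
  norm_num

/-- Scaling splits off `log ‖u‖`, and the integral for the unit vector is rotation invariant, hence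
constant. No absolute value is written because `Real.log` is even. -/
lemma exists_integral_sphere_log_inner (hn : 1 ≤ n) :
    ∃ C : ℝ, ∀ u : EuclideanSpace ℝ (Fin n), u ≠ 0 →
      ∫ θ : Metric.sphere (0 : EuclideanSpace ℝ (Fin n)) 1,
        Real.log ⟪u, (θ : EuclideanSpace ℝ (Fin n))⟫
        ∂(volume : Measure (EuclideanSpace ℝ (Fin n))).toSphere =
      sphereMass n * Real.log ‖u‖ + C := by
  have := nontrivial_euclideanSpace hn
  obtain ⟨e, he⟩ := exists_norm_eq (EuclideanSpace ℝ (Fin n)) zero_le_one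
  refine ⟨∫ θ : Metric.sphere (0 : EuclideanSpace ℝ (Fin n)) 1,
        Real.log ⟪e, (θ : EuclideanSpace ℝ (Fin n))⟫
        ∂(volume : Measure (EuclideanSpace ℝ (Fin n))).toSphere, fun u hu => ?_⟩
  have hu' : ‖u‖ ≠ 0 := norm_ne_zero_iff.2 hu
  have hv : ‖‖u‖⁻¹ • u‖ = 1 := by simp [norm_smul, hu']
  rw [← integral_sphere_inner_congr (hv.trans he.symm)]
  have h1 : (fun θ : Metric.sphere (0 : EuclideanSpace ℝ (Fin n)) 1 =>
      Real.log ⟪u, (θ : EuclideanSpace ℝ (Fin n))⟫)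
      =ᵐ[(volume : Measure (EuclideanSpace ℝ (Fin n))).toSphere] fun θ =>
      Real.log ‖u‖ + Real.log ⟪‖u‖⁻¹ • u, (θ : EuclideanSpace ℝ (Fin n))⟫ := by
    filter_upwards [ae_inner_sphere_ne_zero hu] with θ hθ
    rw [real_inner_smul_left, Real.log_mul (inv_ne_zero hu') hθ, Real.log_inv]
    ring
  rw [integral_congr_ae h1, integral_add (integrable_const _) (integrable_sphere_log_inner hn hv),
    integral_const, Measure.toSphere_real_apply_univ, finrank_euclideanSpace_fin, smul_eq_mul,
    sphereMass]

lemma abs_inner_sphere_sub_le {x y : EuclideanSpace ℝ (Fin n)} (hx : ‖x‖ < 1) (hy : ‖y‖ ≤ 1)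
    (θ : Metric.sphere (0 : EuclideanSpace ℝ (Fin n)) 1) :
    |⟪x - y, (θ : EuclideanSpace ℝ (Fin n))⟫| ≤ 2 := by
  refine (abs_real_inner_le_norm _ _).trans ?_
  rw [norm_eq_of_mem_sphere, mul_one]
  exact (norm_sub_le x y).trans (by linarith)

lemma integrable_prod_log_inner (hn : 1 ≤ n) {f : EuclideanSpace ℝ (Fin n) → 𝕜} {M : ℝ}
    (hf : IsBallDensity f M) {x : EuclideanSpace ℝ (Fin n)}
    (hx : x ∈ Metric.ball (0 : EuclideanSpace ℝ (Fin n)) 1) :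
    Integrable (fun p : Metric.sphere (0 : EuclideanSpace ℝ (Fin n)) 1 × EuclideanSpace ℝ (Fin n) =>
      Real.log ⟪x - p.2, (p.1 : EuclideanSpace ℝ (Fin n))⟫ • f p.2)
      ((volume : Measure (EuclideanSpace ℝ (Fin n))).toSphere.prod volume) := by
  have hm : Measurable fun p : Metric.sphere (0 : EuclideanSpace ℝ (Fin n)) 1 ×
      EuclideanSpace ℝ (Fin n) => Real.log ⟪x - p.2, (p.1 : EuclideanSpace ℝ (Fin n))⟫ := by
    fun_prop
  have hm2 : AEStronglyMeasurable (fun p : Metric.sphere (0 : EuclideanSpace ℝ (Fin n)) 1 ×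
      EuclideanSpace ℝ (Fin n) => f p.2)
      ((volume : Measure (EuclideanSpace ℝ (Fin n))).toSphere.prod volume) :=
    hf.meas.comp_snd
  have h1 := ((integrable_prod_abs_inner_rpow hn hf (s := 1 / 2) (by norm_num) hx).norm).const_mul 4
  refine h1.mono' (hm.aestronglyMeasurable.smul hm2) (Eventually.of_forall fun p => ?_)
  by_cases hp : 1 < ‖p.2‖
  · simp [hf.supp _ hp]
  · rw [norm_smul, norm_smul, ← mul_assoc, Real.norm_eq_abs, Real.norm_of_nonneg (by positivity)]
    refine mul_le_mul_of_nonneg_right ?_ (norm_nonneg _)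
    refine (abs_log_le_four_mul_rpow (abs_inner_sphere_sub_le (by simpa using hx) (not_lt.1 hp) _)).trans_eq
      (by norm_num)

lemma integrable_log_norm_smul (hn : 1 ≤ n) {f : EuclideanSpace ℝ (Fin n) → 𝕜} {M : ℝ}
    (hf : IsBallDensity f M) {x : EuclideanSpace ℝ (Fin n)}
    (hx : x ∈ Metric.ball (0 : EuclideanSpace ℝ (Fin n)) 1) :
    Integrable (fun y => Real.log ‖x - y‖ • f y) := by
  have h1 := ((integrable_norm_rpow_smul hn hf (a := 1 / 2)
    (by have : (1 : ℝ) ≤ n := by exact_mod_cast hn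
        linarith) hx).norm).const_mul 4
  have hm : Measurable fun y : EuclideanSpace ℝ (Fin n) => Real.log ‖x - y‖ := by fun_prop
  refine h1.mono' (hm.aestronglyMeasurable.smul hf.meas) (Eventually.of_forall fun y => ?_)
  by_cases hy : 1 < ‖y‖
  · simp [hf.supp _ hy]
  · rw [norm_smul, norm_smul, ← mul_assoc, Real.norm_eq_abs, Real.norm_of_nonneg (by positivity)]
    refine mul_le_mul_of_nonneg_right ?_ (norm_nonneg _)
    have hx' : ‖x‖ < 1 := by simpa using hx
    have h2 := abs_log_le_four_mul_rpow (a := ‖x - y‖)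
      (by rw [abs_norm]; exact (norm_sub_le x y).trans (by linarith))
    rwa [abs_norm] at h2

/-- The dual Radon transform of the logarithmic transform is a logarithmic potential, up to a
constant. -/
theorem exists_integral_sphere_logTransform (hn : 1 ≤ n) {f : EuclideanSpace ℝ (Fin n) → 𝕜} {M : ℝ}
    (hf : IsBallDensity f M) :
    ∃ C : 𝕜, ∀ x ∈ Metric.ball (0 : EuclideanSpace ℝ (Fin n)) 1,
      ∫ θ : Metric.sphere (0 : EuclideanSpace ℝ (Fin n)) 1,
        logTransform (radonTransform f) θ ⟪x, (θ : EuclideanSpace ℝ (Fin n))⟫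
        ∂(volume : Measure (EuclideanSpace ℝ (Fin n))).toSphere =
      sphereMass n • (∫ y, Real.log ‖x - y‖ • f y) + C := by
  obtain ⟨C, hC⟩ := exists_integral_sphere_log_inner hn
  refine ⟨C • ∫ y, f y, fun x hx => ?_⟩
  have hprod := integrable_prod_log_inner hn hf hx
  have h1 : ∀ᵐ θ ∂(volume : Measure (EuclideanSpace ℝ (Fin n))).toSphere,
      logTransform (radonTransform f) θ ⟪x, (θ : EuclideanSpace ℝ (Fin n))⟫ =
        ∫ y, Real.log ⟪x - y, (θ : EuclideanSpace ℝ (Fin n))⟫ • f y := by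
    filter_upwards [hprod.prod_right_ae] with θ hθ
    have h2 := integral_ridge_smul θ f
      (fun t => Real.log (⟪x, (θ : EuclideanSpace ℝ (Fin n))⟫ - t))
      (by simpa only [inner_sub_left] using hθ)
    simp only [inner_sub_left]
    -- The range `[-1, 1]` can be extended to the whole line, because the Radon transform vanishes
    -- for `|t| > 1`.
    rw [h2, logTransform, intervalIntegral.integral_of_le (by norm_num), ← integral_Icc_eq_integral_Ioc,
      setIntegral_eq_integral_of_forall_compl_eq_zero]
    · simp_rw [Real.log_abs]
    · intro t ht
      rw [radonTransform_eq_zero hf θ, smul_zero]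
      rw [Set.mem_Icc, ← abs_le, not_le] at ht
      exact ht
  rw [integral_congr_ae h1, integral_integral_swap hprod]
  have h3 : (fun y => ∫ θ : Metric.sphere (0 : EuclideanSpace ℝ (Fin n)) 1,
      Real.log ⟪x - y, (θ : EuclideanSpace ℝ (Fin n))⟫ • f y
      ∂(volume : Measure (EuclideanSpace ℝ (Fin n))).toSphere) =ᵐ[volume]
      fun y => sphereMass n • Real.log ‖x - y‖ • f y + C • f y := by
    filter_upwards [ae_ne hn x] with y hy
    rw [integral_smul_const, hC _ hy, add_smul, mul_smul]
  have i1 : Integrable fun y => sphereMass n • Real.log ‖x - y‖ • f y :=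
    (integrable_log_norm_smul hn hf hx).smul (sphereMass n)
  have i2 : Integrable fun y => C • f y := hf.integrable.smul C
  rw [integral_congr_ae h3, integral_add i1 i2, integral_smul, integral_smul]

end LogBackprojection

/-! ### Sphere area, Gamma values and the kernels at zero regularization -/

section Constants

variable {n : ℕ} {𝕜 : Type*} [RCLike 𝕜]

lemma unitSphereArea_eq (hn : 1 ≤ n) : unitSphereArea n = sphereMass n := by
  have hn0 : (0 : ℝ) < n := by exact_mod_cast hn
  have : Nonempty (Fin n) := ⟨⟨0, hn⟩⟩
  have hΓ : 0 < Real.Gamma ((n : ℝ) / 2) := Real.Gamma_pos_of_pos (by positivity)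
  rw [unitSphereArea, sphereMass, Measure.real, EuclideanSpace.volume_ball, Fintype.card_fin,
    ENNReal.toReal_mul, ENNReal.toReal_ofReal, Real.Gamma_add_one (by positivity)]
  · rw [Real.sqrt_eq_rpow, ← Real.rpow_natCast, ← Real.rpow_mul Real.pi_pos.le]
    have : 1 / 2 * (n : ℝ) = n / 2 := by ring
    rw [this]
    simp
    field_simp
  · have := Real.Gamma_pos_of_pos (s := (n : ℝ) / 2 + 1) (by positivity)
    positivity

lemma sphereMass_pos (hn : 1 ≤ n) : 0 < sphereMass n := by
  have hn0 : (0 : ℝ) < n := by exact_mod_cast hn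
  have hΓ : 0 < Real.Gamma ((n : ℝ) / 2) := Real.Gamma_pos_of_pos (by positivity)
  rw [← unitSphereArea_eq hn, unitSphereArea]
  positivity

/-- The product of odd numbers is the one that iterated Laplacians produce from `d = 1`, so it
cancels against `Γ(n / 2)` for odd `n`. -/
lemma Gamma_add_half_eq_prod (k : ℕ) :
    Real.Gamma ((k : ℝ) + 1 / 2) =
      √Real.pi * (∏ j ∈ Finset.range k, (1 + 2 * (j : ℝ))) / 2 ^ k := by
  induction k with
  | zero => simpa using Real.Gamma_one_half_eq
  | succ k ih =>
    have h : ((k + 1 : ℕ) : ℝ) + 1 / 2 = ((k : ℝ) + 1 / 2) + 1 := by push_cast; ring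
    rw [h, Real.Gamma_add_one (by positivity), ih, Finset.prod_range_succ, pow_succ]
    field_simp
    ring

lemma potential_powKernel_one_eq (f : EuclideanSpace ℝ (Fin n) → 𝕜)
    (x : EuclideanSpace ℝ (Fin n)) :
    potential f (powKernel 𝕜 1) 0 x = ∫ y, ‖x - y‖⁻¹ • f y := by
  rw [potential]
  refine integral_congr_ae (Eventually.of_forall fun y => ?_)
  have h : (‖x - y‖ ^ 2) ^ (-(1 : ℝ) / 2) = ‖x - y‖⁻¹ := by
    rw [← Real.rpow_natCast, ← Real.rpow_mul (norm_nonneg _), ← Real.rpow_neg_one]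
    congr 1
    norm_num
  simp [powKernel, sqLength, h, RCLike.real_smul_eq_coe_mul, mul_comm]

lemma potential_logKernel_eq (f : EuclideanSpace ℝ (Fin n) → 𝕜) (x : EuclideanSpace ℝ (Fin n)) :
    potential f (logKernel 𝕜) 0 x = ∫ y, Real.log ‖x - y‖ • f y := by
  rw [potential]
  refine integral_congr_ae (Eventually.of_forall fun y => ?_)
  have h : Real.log (sqLength (x - y, (0 : ℝ))) / 2 = Real.log ‖x - y‖ := by
    simp [sqLength, Real.log_pow]
  simp only [logKernel, h]
  rw [RCLike.real_smul_eq_coe_mul, smul_eq_mul, mul_comm]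

end Constants

/-! ### Extension by zero -/

section BallExtension

variable {n : ℕ} {𝕜 : Type*} [RCLike 𝕜]

lemma isBallDensity_ballExtension {φ : EuclideanSpace ℝ (Fin n) → 𝕜}
    (hφ : ContinuousOn φ (Metric.closedBall 0 1)) :
    (∃ M, IsBallDensity (ballExtension φ) M) ∧ Measurable (ballExtension φ) := by
  have hm : Measurable (ballExtension φ) := by
    classical
    rw [ballExtension, ← Set.piecewise_eq_indicator]
    exact hφ.measurable_piecewise continuousOn_const Metric.isClosed_closedBall.measurableSet
  obtain ⟨C, hC⟩ := (isCompact_closedBall (0 : EuclideanSpace ℝ (Fin n)) 1).exists_bound_of_continuousOn hφ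
  refine ⟨⟨|C|, hm.aestronglyMeasurable, fun y => ?_, fun y hy => ?_⟩, hm⟩
  · by_cases hy : y ∈ Metric.closedBall (0 : EuclideanSpace ℝ (Fin n)) 1
    · rw [ballExtension, Set.indicator_of_mem hy]
      exact (hC y hy).trans (le_abs_self C)
    · rw [ballExtension, Set.indicator_of_notMem hy, norm_zero]
      positivity
  · exact Set.indicator_of_notMem (by simpa using hy) _

lemma ballExtension_eqOn (φ : EuclideanSpace ℝ (Fin n) → 𝕜) :
    Set.EqOn (ballExtension φ) φ (Metric.ball 0 1) := fun _ hx =>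
  Set.indicator_of_mem (Metric.ball_subset_closedBall hx) _

lemma continuousAt_ballExtension {φ : EuclideanSpace ℝ (Fin n) → 𝕜}
    (hφ : ContinuousOn φ (Metric.closedBall 0 1)) {z : EuclideanSpace ℝ (Fin n)} (hz : ‖z‖ ≠ 1) :
    ContinuousAt (ballExtension φ) z := by
  rcases lt_or_gt_of_ne hz with h | h
  · have hz' : z ∈ Metric.ball (0 : EuclideanSpace ℝ (Fin n)) 1 := by simpa using h
    have hb := Metric.isOpen_ball.mem_nhds hz'
    refine (hφ.continuousAt (Filter.mem_of_superset hb Metric.ball_subset_closedBall)).congr ?_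
    filter_upwards [hb] with y hy
    exact (ballExtension_eqOn φ hy).symm
  · have hz' : z ∈ (Metric.closedBall (0 : EuclideanSpace ℝ (Fin n)) 1)ᶜ := by simpa using h
    refine (continuousAt_const (y := (0 : 𝕜))).congr ?_
    filter_upwards [Metric.isClosed_closedBall.isOpen_compl.mem_nhds hz'] with y hy
    exact (Set.indicator_of_notMem hy _).symm

end BallExtension

/-! ### The inversion formulas -/

theorem theorem2p5 {𝕜 : Type*} [RCLike 𝕜] (n : ℕ) (hn : 2 ≤ n)
    (lam : ℝ≥0) (hlam0 : 0 < lam) (hlam1 : lam ≤ 1)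
    (φ : EuclideanSpace ℝ (Fin n) → 𝕜)
    (hφ : ∃ A : ℝ≥0, HolderOnWith A lam φ (Metric.closedBall 0 1))
    (Φ : Metric.sphere (0 : EuclideanSpace ℝ (Fin n)) 1 → ℝ → 𝕜)
    (hΦ : Φ = radonTransform (ballExtension φ)) :
    (Odd n →
      ContDiffOn ℝ ((n - 1 : ℕ) : WithTop ℕ∞) (dualRadonTransform Φ) (Metric.ball 0 1) ∧
      ∀ x ∈ Metric.ball (0 : EuclideanSpace ℝ (Fin n)) 1,
        φ x = (Real.pi ^ (1 - (n : ℝ) / 2) / (2 ^ (n - 1) * Real.Gamma ((n : ℝ) / 2))) •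
          negLaplacianPow ((n - 1) / 2) (dualRadonTransform Φ) x) ∧
    (Even n →
      ContDiffOn ℝ (n : WithTop ℕ∞) (dualRadonTransform (logTransform Φ)) (Metric.ball 0 1) ∧
      ∀ x ∈ Metric.ball (0 : EuclideanSpace ℝ (Fin n)) 1,
        φ x = (-Real.pi ^ (-(n : ℝ) / 2) / (2 ^ (n - 1) * Real.Gamma ((n : ℝ) / 2))) •
          negLaplacianPow (n / 2) (dualRadonTransform (logTransform Φ)) x) := by
  subst hΦ
  obtain ⟨A, hA⟩ := hφ
  have hφc : ContinuousOn φ (Metric.closedBall 0 1) := hA.continuousOn hlam0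
  obtain ⟨⟨M, hf⟩, hfm⟩ := isBallDensity_ballExtension hφc
  have hfc : ∀ z, ‖z‖ ≠ 1 → ContinuousAt (ballExtension φ) z :=
    fun z hz => continuousAt_ballExtension hφc hz
  have hfc' : ∀ x ∈ Metric.ball (0 : EuclideanSpace ℝ (Fin n)) 1,
      ContinuousAt (ballExtension φ) x := fun x hx => hfc x (by
    rw [mem_ball_zero_iff] at hx
    exact hx.ne)
  have hfA : ∀ x ∈ Metric.ball (0 : EuclideanSpace ℝ (Fin n)) 1,
      ∀ y ∈ Metric.ball (0 : EuclideanSpace ℝ (Fin n)) 1,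
      ‖ballExtension φ x - ballExtension φ y‖ ≤ (A : ℝ) * ‖x - y‖ ^ (lam : ℝ) := by
    intro x hx y hy
    rw [ballExtension_eqOn φ hx, ballExtension_eqOn φ hy, ← dist_eq_norm, ← dist_eq_norm]
    exact hA.dist_le (Metric.ball_subset_closedBall hx) (Metric.ball_subset_closedBall hy)
  have hlam : (0 : ℝ) < lam := by exact_mod_cast hlam0
  have hn1 : 1 ≤ n := by omega
  have hσ := sphereMass_pos hn1
  constructor
  · intro hodd
    -- An odd `n ≥ 2` is at least `3`, so at least one Laplacian is applied.
    obtain ⟨m, rfl⟩ : ∃ m, n = 2 * m + 3 := by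
      obtain ⟨k, hk⟩ := hodd
      exact ⟨k - 1, by omega⟩
    have heq : Set.EqOn (dualRadonTransform (radonTransform (ballExtension φ)))
        (((sphereMass (2 * m + 3))⁻¹ * (2 * Real.pi ^ (m + 1) / m.factorial)) •
          potential (ballExtension φ) (powKernel 𝕜 1) 0) (Metric.ball 0 1) := by
      intro x hx
      have hm : ((2 * m + 3 - 1 : ℕ) : ℝ) / 2 = m + 1 := by
        rw [show 2 * m + 3 - 1 = 2 * (m + 1) by omega]
        push_cast
        ring
      rw [dualRadonTransform, unitSphereArea_eq hn1, Pi.smul_apply, mul_smul,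
        potential_powKernel_one_eq, integral_sphere_radonTransform hn hf hfm hfc hx, hm,
        Real.Gamma_nat_eq_factorial, ← Nat.cast_succ, Real.rpow_natCast]
    refine ⟨((contDiffOn_potential_powKernel_one hn hf hlam hfA).const_smul
      ((sphereMass (2 * m + 3))⁻¹ * (2 * Real.pi ^ (m + 1) / m.factorial))).congr
        fun x hx => heq hx, fun x hx => ?_⟩
    rw [show (2 * m + 3 - 1) / 2 = m + 1 by omega,
      negLaplacianPow_congr Metric.isOpen_ball (m + 1) heq hx, negLaplacianPow_const_smul,
      Pi.smul_apply, negLaplacianPow_potential_powKernel hf hlam hfA hfc' m 1 (by omega) x hx,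
      ballExtension_eqOn φ hx, smul_smul, smul_smul]
    have hΓ := Gamma_add_half_eq_prod (m + 1)
    have hP : 0 < ∏ j ∈ Finset.range (m + 1), (1 + 2 * (j : ℝ)) :=
      Finset.prod_pos fun j _ => by positivity
    have hn2 : ((2 * m + 3 : ℕ) : ℝ) / 2 = ((m + 1 : ℕ) : ℝ) + 1 / 2 := by
      push_cast
      ring
    have hpi : Real.pi ^ (1 - (((m + 1 : ℕ) : ℝ) + 1 / 2)) = √Real.pi / Real.pi ^ (m + 1) := by
      rw [Real.sqrt_eq_rpow, ← Real.rpow_natCast, ← Real.rpow_sub Real.pi_pos]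
      congr 1
      ring
    rw [hn2, hΓ, hpi, show 2 * m + 3 - 1 = 2 * (m + 1) by omega, pow_mul]
    have hπ := Real.pi_pos
    have hsq : 0 < √Real.pi := Real.sqrt_pos.2 hπ
    have hfac : (0 : ℝ) < m.factorial := by exact_mod_cast m.factorial_pos
    have h4 : ((2 : ℝ) ^ 2) ^ (m + 1) = 2 ^ (m + 1) * 2 ^ (m + 1) := by
      rw [← mul_pow]
      norm_num
    -- Both sides become multiples of `φ x`; what is left is that the product of all constants
    -- equals `1`.
    conv_lhs => rw [← one_smul ℝ (φ x)]
    congr 1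
    rw [h4]
    push_cast
    field_simp
    ring
  · intro heven
    obtain ⟨m, rfl⟩ : ∃ m, n = 2 * m + 2 := by
      obtain ⟨k, hk⟩ := heven
      exact ⟨k - 1, by omega⟩
    obtain ⟨C, hC⟩ := exists_integral_sphere_logTransform hn1 hf
    have heq : Set.EqOn (dualRadonTransform (logTransform (radonTransform (ballExtension φ))))
        (fun x => potential (ballExtension φ) (logKernel 𝕜) 0 x + (sphereMass (2 * m + 2))⁻¹ • C)
        (Metric.ball 0 1) := by
      intro x hx
      beta_reduce
      rw [dualRadonTransform, unitSphereArea_eq hn1, hC x hx, smul_add, smul_smul,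
        inv_mul_cancel₀ hσ.ne', one_smul, potential_logKernel_eq]
    refine ⟨((contDiffOn_potential_logKernel hn hf hlam hfA).add contDiffOn_const).congr heq,
      fun x hx => ?_⟩
    -- At least one Laplacian is applied, and it annihilates the additive constant of the
    -- logarithmic potential.
    have hsucc : negLaplacianPow (m + 1) (fun x => potential (ballExtension φ) (logKernel 𝕜) 0 x +
        (sphereMass (2 * m + 2))⁻¹ • C) =
        negLaplacianPow (m + 1) (potential (ballExtension φ) (logKernel 𝕜) 0) := by
      rw [negLaplacianPow_succ, negLaplacianPow_succ, laplacian_add_const]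
    rw [show (2 * m + 2) / 2 = m + 1 by omega,
      negLaplacianPow_congr Metric.isOpen_ball (m + 1) heq hx, hsucc,
      negLaplacianPow_potential_logKernel hf hlam hfA hfc' (by omega) hx,
      ballExtension_eqOn φ hx, smul_smul, ← unitSphereArea_eq hn1, unitSphereArea]
    have hn2 : ((2 * m + 2 : ℕ) : ℝ) / 2 = (m : ℝ) + 1 := by
      push_cast
      ring
    have hpi : Real.pi ^ (-((2 * m + 2 : ℕ) : ℝ) / 2) = (Real.pi ^ (m + 1))⁻¹ := by
      rw [neg_div, hn2, Real.rpow_neg Real.pi_pos.le, ← Nat.cast_succ, Real.rpow_natCast]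
    have h4 : (2 : ℝ) ^ (2 * m + 1) = 4 ^ m * 2 := by
      rw [pow_succ, pow_mul]
      norm_num
    rw [hpi, hn2, Real.Gamma_nat_eq_factorial, ← Nat.cast_succ, Real.rpow_natCast,
      show 2 * m + 2 - 1 = 2 * m + 1 by omega, h4]
    have hπ := Real.pi_pos
    have hfac : (0 : ℝ) < m.factorial := by exact_mod_cast m.factorial_pos
    conv_lhs => rw [← one_smul ℝ (φ x)]
    congr 1
    norm_num
    field_simp
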